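/- Throughout, $[n]=\{1,\dots,n\}$, and $P_j$ is the path on $[j]$ with edges $\{i,i+1\}$. For a finite multigraph $M$ (loops allowed) let $X_M(\mathbf x)=\sum_\kappa\prod_{v}x_{\kappa(v)}$ be its chromatic symmetric function, where $\kappa$ runs over all proper colourings of the vertices of $M$ by positive integers (the two ends of every edge get different colours, so $X_M=0$ if $M$ has a loop). For a finite multiset $\lambda$ of positive integers let $e_\lambda=\prod_i e_{\lambda_i}$, where $e_k=\sum_{i_1<\cdots<i_k}x_{i_1}\cdots x_{i_k}$. Let $G=([n],E)$ be a simple graph with $n\ge 2$. For $j\ge1$ let $G+P_j$ be the graph on $[n+j-1]$ with edge set $E\cup\{\{n+t-1,n+t\}: 1\le t\le j-1\}$, and fix a total order on the edges of $G+P_j$. A *tree triple* of $G+P_j$ is a triple $(T,\alpha,r)$ consisting of a subtree $T$ of $G+P_j$ whose edge set contains no set of the form $C\setminus\{\max C\}$ with $C$ the edge set of a cycle of $G+P_j$, a composition $\alpha=(\alpha_1,\dots,\alpha_\ell)$ of the number of vertices of $T$, and an integer $1\le r\le\alpha_1$. A *forest triple* of $G+P_j$ is a sequence $\mathcal F=((T_1,\alpha^{(1)},r_1),\dots,(T_m,\alpha^{(m)},r_m))$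 of tree triples such that every vertex lies in exactly one $T_i$ and $\min T_1<\cdots<\min T_m$. Put $\operatorname{sign}(\mathcal F)=(-1)^{\sum_i(\ell(\alpha^{(i)})-1)}$ and let $\operatorname{type}'(\mathcal F)$ be the multiset of all parts of $\alpha^{(1)},\dots,\alpha^{(m)}$ with one instance of $\alpha^{(1)}_1$ removed. For $i,j\ge1$ let $\mathrm{FT}^{(i)}(G+P_j)$ be the set of forest triples of $G+P_j$ for which the tree triple $(T,\alpha,r)$ with $1\in T$ satisfies $\alpha_1=i$ and $r=1$, and the tree triple $(T',\alpha',r')$ with $n\in T'$ satisfies $\{n,n+1,\dots,n+j-1\}\subseteq T'$ and has last part $\alpha'_\ell\ge j$. The *forest triple matrix* $F_G$ is the infinite matrix with entries $$(F_G)_{i,j}=\sum_{\mathcal F\in\mathrm{FT}^{(i)}(G+P_j)}\operatorname{sign}(\mathcal F)\,e_{\operatorname{type}'(\mathcal F)}\qquad(i,j\ge1).$$ Let $G^\circ$ be the multigraph on $[n-1]$ obtained from $G$ by identifying the vertices $1$ and $n$; each edge of $G$ gives one edge of $G^\circ$, so multiple edges may arise, and an edge $\{1,n\}$ becomes a loop.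 **Theorem.** For every choice of the total orders, $(F_G)_{k,k}=0$ for all $k\ge n$, and $$X_{G^\circ}(\mathbf x)=\operatorname{trace}(F_G)=\sum_{k\ge1}(F_G)_{k,k}=\sum_{k=1}^{n-1}(F_G)_{k,k}.$$ -/

import Mathlib

/-! Vertices are indexed from `0`: the vertex `v ∈ {1, …, n}` is the element of `Fin n` with value
`v - 1`. Symmetric functions are power series over `ℤ` in the variables `x₁, x₂, …`, indexed
by `ℕ+`. -/

noncomputable section

namespace ForestTriples

/-! ### Symmetric functions -/

/-- The ring of formal power series in the variables `x₁, x₂, x₃, …`. -/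
abbrev PowerSeriesRing : Type := MvPowerSeries ℕ+ ℤ

open Classical in
/-- The elementary symmetric function `e_k`: the sum of the squarefree monomials
`∏ i ∈ s, x_i` over all `k`-element sets `s` of positive integers. -/
def elementary (k : ℕ) : PowerSeriesRing := fun d =>
  if ∃ s : Finset ℕ+, s.card = k ∧ ∑ i ∈ s, Finsupp.single i 1 = d then 1 else 0

/-- `e_λ = ∏ e_{λ_i}`, where the partition `λ` is given by the multiset of its parts. -/
def elementaryProd (lam : Multiset ℕ) : PowerSeriesRing := (lam.map elementary).prod

/-- Proper colourings of a multigraph (possibly with loops) by positive integers. A multigraph with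
a loop has none. -/
def IsProperColouring {α β : Type*} (M : Graph α β) (κ : M.vertexSet → ℕ+) : Prop :=
  ∀ (e : β) (x y : M.vertexSet), M.IsLink e x y → κ x ≠ κ y

/-- The chromatic symmetric function `∑_κ ∏_v x_{κ v}`, summed over the proper colourings `κ`:
the coefficient of a monomial is the (finite) number of proper colourings with that monomial. -/
def chromaticSymmetricFunction {α β : Type*} [Finite α] (M : Graph α β) : PowerSeriesRing :=
  fun d => (Nat.card {κ : M.vertexSet → ℕ+ //
    IsProperColouring M κ ∧ ∑ᶠ v, Finsupp.single (κ v) 1 = d} : ℤ)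

/-! ### Gluing -/

/-- The graph `G + H` on `n + m - 1` vertices, obtained by gluing the last vertex of `G` to the
first vertex of `H`. -/
def glue {n m : ℕ} (G : SimpleGraph (Fin n)) (H : SimpleGraph (Fin m)) :
    SimpleGraph (Fin (n + m - 1)) where
  Adj a b :=
    (∃ u v : Fin n, G.Adj u v ∧ a.val = u.val ∧ b.val = v.val) ∨
    (∃ u v : Fin m, H.Adj u v ∧ a.val = u.val + (n - 1) ∧ b.val = v.val + (n - 1))
  symm := ⟨by
    rintro a b (⟨u, v, h, ha, hb⟩ | ⟨u, v, h, ha, hb⟩)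
    · exact Or.inl ⟨v, u, h.symm, hb, ha⟩
    · exact Or.inr ⟨v, u, h.symm, hb, ha⟩⟩
  loopless := ⟨by
    rintro a (⟨u, v, h, ha, hb⟩ | ⟨u, v, h, ha, hb⟩)
    · exact h.ne (Fin.ext (by omega))
    · exact h.ne (Fin.ext (by omega))⟩

/-- The map `{1, …, n} → {1, …, n - 1}` that sends `n` to `1` and fixes all other vertices. -/
def identifyEnds {n : ℕ} (hn : 2 ≤ n) (v : Fin n) : Fin (n - 1) :=
  if h : v.val < n - 1 then ⟨v.val, h⟩ else ⟨0, by omega⟩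

/-- The multigraph `G°` on `n - 1` vertices obtained from `G` by gluing the vertices `1` and `n`.
Each edge of `G` gives one edge of `G°`; in particular an edge `{1, n}` becomes a loop. -/
def closeUp {n : ℕ} (hn : 2 ≤ n) (G : SimpleGraph (Fin n)) :
    Graph (Fin (n - 1)) (Sym2 (Fin n)) where
  vertexSet := Set.univ
  IsLink e x y := e ∈ G.edgeSet ∧ e.map (identifyEnds hn) = s(x, y)
  isLink_symm := fun _ _ => ⟨fun _ _ h => ⟨h.1, h.2.trans Sym2.eq_swap⟩⟩
  eq_or_eq_of_isLink_of_isLink := by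
    intro e x y v w h h'
    have := h.2.symm.trans h'.2
    rw [Sym2.eq_iff] at this
    tauto
  left_mem_of_isLink := fun _ _ _ _ => Set.mem_univ _

/-! ### Forest triples -/

variable {N : ℕ}

/-- `B` is a broken circuit: `B = C \ {max C}` for the edge set `C` of a cycle of `G`, the maximum
being taken with respect to the total order `o` of the edges. -/
def IsBrokenCircuit (G : SimpleGraph (Fin N)) (o : LinearOrder G.edgeSet)
    (B : Set (Sym2 (Fin N))) : Prop :=
  ∃ (v : Fin N) (c : G.Walk v v) (e : G.edgeSet), c.IsCycle ∧ e.val ∈ c.edges ∧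
    (∀ f : G.edgeSet, f.val ∈ c.edges → o.le f e) ∧ B = {f | f ∈ c.edges} \ {e.val}

/-- The subgraph `T` is a no-broken-circuit tree of `G`. -/
def IsNBCTree (G : SimpleGraph (Fin N)) (o : LinearOrder G.edgeSet) (T : G.Subgraph) : Prop :=
  T.coe.IsTree ∧ ∀ B, IsBrokenCircuit G o B → ¬ B ⊆ T.edgeSet

/-- Tree triples `(T, α, r)`: an NBC tree `T`, a composition `α` of `|T|` (a list of positive
integers with sum `|T|`) and an integer `1 ≤ r ≤ α₁`. -/
@[ext]
structure TreeTriple (G : SimpleGraph (Fin N)) (o : LinearOrder G.edgeSet) where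
  tree : G.Subgraph
  comp : List ℕ
  r : ℕ
  isNBCTree : IsNBCTree G o tree
  comp_pos : ∀ a ∈ comp, 0 < a
  comp_sum : comp.sum = tree.verts.ncard
  one_le_r : 1 ≤ r
  r_le : r ≤ comp.headD 0

variable {G : SimpleGraph (Fin N)} {o : LinearOrder G.edgeSet}

/-- The (value of the) smallest vertex of the tree. -/
def TreeTriple.minVertex (A : TreeTriple G o) : ℕ := sInf (Fin.val '' A.tree.verts)

/-- Forest triples: sequences of tree triples such that every vertex lies in exactly one of the
trees, ordered by the smallest vertices of the trees. -/
@[ext]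
structure ForestTriple (G : SimpleGraph (Fin N)) (o : LinearOrder G.edgeSet) where
  triples : List (TreeTriple G o)
  existsUnique_mem : ∀ v : Fin N, ∃! i : Fin triples.length, v ∈ (triples.get i).tree.verts
  sorted : triples.Pairwise fun A B => A.minVertex < B.minVertex

/-- The type: the partition whose parts are the parts of all the compositions. -/
def ForestTriple.type (F : ForestTriple G o) : Multiset ℕ :=
  (F.triples.flatMap TreeTriple.comp : List ℕ)

/-- The sign `(-1) ^ ∑ (ℓ(α⁽ⁱ⁾) - 1)`. -/
def ForestTriple.sign (F : ForestTriple G o) : ℤ :=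
  (-1) ^ (F.triples.map fun A => A.comp.length - 1).sum

/-- `α⁽¹⁾₁`, the first part of the composition of the first tree triple. -/
def ForestTriple.firstPart (F : ForestTriple G o) : ℕ :=
  (F.triples.map fun A => A.comp.headD 0).headD 0

/-- The reduced type: the type with one instance of `α⁽¹⁾₁` removed. -/
def ForestTriple.reducedType (F : ForestTriple G o) : Multiset ℕ := F.type.erase F.firstPart

/-! ### The forest triple matrix -/

/-- The set `FT⁽ⁱ⁾(G + P_j)` of the forest triples of `G + P_j` such that the tree triple
`(T, α, r)` with `1 ∈ T` has `α₁ = i` and `r = 1`, and the tree triple `(T', α', r')` with `n ∈ T'`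
has `{n, n + 1, …, n + j - 1} ⊆ T'` and last part `α'_ℓ ≥ j`. -/
def restrictedForestTriples {n : ℕ} (G : SimpleGraph (Fin n)) (i j : ℕ+)
    (o : LinearOrder (glue G (SimpleGraph.pathGraph (j : ℕ))).edgeSet) :
    Set (ForestTriple (glue G (SimpleGraph.pathGraph (j : ℕ))) o) :=
  {F | (∃ A ∈ F.triples, (∃ v ∈ A.tree.verts, v.val = 0) ∧
          A.comp.headD 0 = (i : ℕ) ∧ A.r = 1) ∧
       (∃ A ∈ F.triples, (∃ v ∈ A.tree.verts, v.val = n - 1) ∧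
          (∀ v, n - 1 ≤ v.val → v ∈ A.tree.verts) ∧ (j : ℕ) ≤ A.comp.getLastD 0)}

/-- The forest triple matrix `F_G`, with rows and columns indexed by the positive integers. It is
computed from a choice of a total order of the edges of `G + P_j` for every `j`. -/
def forestTripleMatrix {n : ℕ} (G : SimpleGraph (Fin n))
    (o : ∀ j : ℕ+, LinearOrder (glue G (SimpleGraph.pathGraph (j : ℕ))).edgeSet) :
    Matrix ℕ+ ℕ+ PowerSeriesRing := fun i j =>
  ∑ᶠ F ∈ restrictedForestTriples G i j (o j), F.sign • elementaryProd F.reducedType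

/-- The trace of an infinite matrix with finitely many nonzero diagonal entries. -/
def infiniteTrace (M : Matrix ℕ+ ℕ+ PowerSeriesRing) : PowerSeriesRing := ∑ᶠ k, M k k

end ForestTriples

end

/-! Both sides are alternating sums over all edge sets $S\subseteq E$, and they agree term by term.

A forest triple is an edge set without broken circuits together with a decoration (composition and
$r$) of each component (`forestTripleEquiv`). For a fixed edge set, the sum over decorations is a
product of factors `treeWeight` over the components, which depend only on the component sizes and on
which components contain the vertices $1$ and $n$. Whitney's cancellation
(`sum_powerset_eq_sum_noBrokenCircuit`) holds for any function of the partition into components, so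
the chosen order disappears and the sum runs over all edge sets. The condition on the path forces
every path edge into the set, so only an edge set of $G$ remains free
(`forestTripleMatrix_eq_sum_powerset`).

An ordinary component of size $m$ has weight $(-1)^{m-1}p_m$. For the components of $1$ and $n$,
write $E=\sum e_st^s$, so that $1/E$ generates the signed complete functions, and sum over the
diagonal index. If $1$ and $n$ lie in different components of sizes $a$ and $b$, the weights are a
coefficient of $1/E$ and one of $E\cdot\sum_u\pm p_{b+u}t^u$; their convolution is $\pm p_{a+b-1}$
(`sum_treeWeight_mul_treeWeight`). If they share a component of size $c+1$, each $e_s$ is counted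
$s$ times, and Newton's formula gives $\pm p_c$ (`sum_treeWeight`). These are the component sizes
after gluing $1$ to $n$, so the result is the power sum expansion of $X_{G^\circ}$
(`chromaticSymmetricFunction_closeUp_eq_sum`, `sum_diagonalProduct`). -/

noncomputable section

namespace ForestTriples

/-! ### Sums over compositions -/

/-- The compositions of `m`, as lists of positive integers. -/
def compositionLists (m : ℕ) : Finset (List ℕ) :=
  (Finset.univ : Finset (Composition m)).image Composition.blocks

theorem mem_compositionLists {m : ℕ} {l : List ℕ} :
    l ∈ compositionLists m ↔ (∀ a ∈ l, 0 < a) ∧ l.sum = m := by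
  constructor
  · intro h
    obtain ⟨α, -, rfl⟩ := Finset.mem_image.1 h
    exact ⟨fun a ha => α.blocks_pos ha, α.blocks_sum⟩
  · rintro ⟨h₁, h₂⟩
    exact Finset.mem_image.2 ⟨⟨l, fun {a} ha => h₁ a ha, h₂⟩, Finset.mem_univ _, rfl⟩

theorem sum_composition {M : Type*} [AddCommMonoid M] {m : ℕ} (f : List ℕ → M) :
    ∑ α : Composition m, f α.blocks = ∑ l ∈ compositionLists m, f l := by
  rw [compositionLists, Finset.sum_image]
  intro a _ b _ h
  exact Composition.ext h

theorem compositionLists_zero : compositionLists 0 = {[]} := by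
  ext l
  rw [mem_compositionLists, Finset.mem_singleton]
  constructor
  · rintro ⟨h₁, h₂⟩
    cases l with
    | nil => rfl
    | cons a l =>
      have := h₁ a (by simp)
      simp at h₂
      omega
  · rintro rfl
    simp

/-- Splitting off the first part of a composition. -/
theorem sum_compositionLists_cons {M : Type*} [AddCommMonoid M] {m : ℕ} (hm : 0 < m)
    (f : List ℕ → M) :
    ∑ l ∈ compositionLists m, f l =
      ∑ k ∈ Finset.Icc 1 m, ∑ l ∈ compositionLists (m - k), f (k :: l) := by
  rw [Finset.sum_sigma']
  refine Finset.sum_bij' (fun l _ => ⟨l.headD 0, l.tail⟩) (fun x _ => x.1 :: x.2) ?_ ?_ ?_ ?_ ?_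
  · intro l hl
    obtain ⟨h₁, h₂⟩ := mem_compositionLists.1 hl
    cases l with
    | nil => simp at h₂; omega
    | cons a l =>
      have := h₁ a (by simp)
      simp only [List.sum_cons] at h₂
      simp only [List.headD_cons, List.tail_cons, Finset.mem_sigma, Finset.mem_Icc,
        mem_compositionLists]
      exact ⟨⟨by omega, by omega⟩, fun b hb => h₁ b (by simp [hb]), by omega⟩
  · rintro ⟨k, l⟩ h
    simp only [Finset.mem_sigma, Finset.mem_Icc, mem_compositionLists] at h
    obtain ⟨⟨h₁, h₂⟩, h₃, h₄⟩ := h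
    simp only [mem_compositionLists, List.mem_cons, List.sum_cons]
    refine ⟨?_, by omega⟩
    rintro a (rfl | ha)
    · omega
    · exact h₃ a ha
  · intro l hl
    obtain ⟨h₁, h₂⟩ := mem_compositionLists.1 hl
    cases l with
    | nil => simp at h₂; omega
    | cons a l => rfl
  · rintro ⟨k, l⟩ _
    rfl
  · intro l hl
    obtain ⟨h₁, h₂⟩ := mem_compositionLists.1 hl
    cases l with
    | nil => simp at h₂; omega
    | cons a l => rfl

theorem sum_compositionLists_reverse {M : Type*} [AddCommMonoid M] (m : ℕ) (f : List ℕ → M) :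
    ∑ l ∈ compositionLists m, f l = ∑ l ∈ compositionLists m, f l.reverse :=
  Finset.sum_nbij' List.reverse List.reverse (by simp [mem_compositionLists])
    (by simp [mem_compositionLists]) (by simp) (by simp) (by simp)

/-- Splitting off the last part of a composition. -/
theorem sum_compositionLists_concat {M : Type*} [AddCommMonoid M] {m : ℕ} (hm : 0 < m)
    (f : List ℕ → M) :
    ∑ l ∈ compositionLists m, f l =
      ∑ k ∈ Finset.Icc 1 m, ∑ l ∈ compositionLists (m - k), f (l ++ [k]) := by
  rw [sum_compositionLists_reverse, sum_compositionLists_cons hm]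
  refine Finset.sum_congr rfl fun k _ => ?_
  rw [sum_compositionLists_reverse]
  simp

/-! ### Complete and power sum symmetric functions -/

theorem elementaryProd_cons (k : ℕ) (l : List ℕ) :
    elementaryProd ((k :: l : List ℕ) : Multiset ℕ) = elementary k * elementaryProd l := by
  simp [elementaryProd]

theorem elementaryProd_concat (k : ℕ) (l : List ℕ) :
    elementaryProd ((l ++ [k] : List ℕ) : Multiset ℕ) = elementaryProd l * elementary k := by
  simp [elementaryProd]

theorem elementaryProd_add (s t : Multiset ℕ) :
    elementaryProd (s + t) = elementaryProd s * elementaryProd t := by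
  simp [elementaryProd]

theorem elementary_zero : elementary 0 = 1 := by
  classical
  ext d
  rw [MvPowerSeries.coeff_one]
  change (if _ then _ else _) = _
  refine if_congr ?_ rfl rfl
  constructor
  · rintro ⟨s, hs, rfl⟩
    rw [Finset.card_eq_zero.1 hs, Finset.sum_empty]
  · rintro rfl
    exact ⟨∅, rfl, rfl⟩

/-- The signed complete symmetric function `(-1)^m h_m`, in its expansion `∑ (-1)^ℓ(α) e_α`. -/
def signedComplete (m : ℕ) : PowerSeriesRing :=
  ∑ l ∈ compositionLists m, (-1) ^ l.length * elementaryProd l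

/-- The signed power sum `(-1)^(m-1) p_m`, in its expansion `∑ (-1)^(ℓ(α)-1) α₁ e_α`. -/
def signedPowerSum (m : ℕ) : PowerSeriesRing :=
  ∑ l ∈ compositionLists m, (-1) ^ (l.length - 1) * (l.headD 0 : PowerSeriesRing) *
    elementaryProd l

theorem signedComplete_zero : signedComplete 0 = 1 := by
  simp [signedComplete, compositionLists_zero, elementaryProd]

/-- Splitting off the first part costs one sign. This is the recursion for the coefficients of the
inverse of $\sum_k e_kt^k$. -/
theorem signedComplete_eq {m : ℕ} (hm : 0 < m) :
    signedComplete m = -∑ k ∈ Finset.Icc 1 m, elementary k * signedComplete (m - k) := by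
  rw [signedComplete, sum_compositionLists_cons hm, ← Finset.sum_neg_distrib]
  refine Finset.sum_congr rfl fun k _ => ?_
  rw [signedComplete, Finset.mul_sum, ← Finset.sum_neg_distrib]
  refine Finset.sum_congr rfl fun l _ => ?_
  rw [elementaryProd_cons, List.length_cons, pow_succ]
  ring

theorem signedPowerSum_zero : signedPowerSum 0 = 0 := by
  simp [signedPowerSum, compositionLists_zero]

/-- The weight $\alpha_1$ sees only the first part, so the remaining parts sum freely to a signed
complete function. -/
theorem signedPowerSum_eq (m : ℕ) :
    signedPowerSum m = ∑ k ∈ Finset.Icc 1 m, (k : PowerSeriesRing) * elementary k *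
      signedComplete (m - k) := by
  rcases Nat.eq_zero_or_pos m with rfl | hm
  · simp [signedPowerSum_zero]
  rw [signedPowerSum, sum_compositionLists_cons hm]
  refine Finset.sum_congr rfl fun k _ => ?_
  rw [signedComplete, Finset.mul_sum]
  refine Finset.sum_congr rfl fun l _ => ?_
  rw [elementaryProd_cons, List.length_cons, List.headD_cons, Nat.add_sub_cancel]
  ring

theorem sum_range_succ_eq_add_sum_Icc {M : Type*} [AddCommMonoid M] (f : ℕ → M) (m : ℕ) :
    ∑ k ∈ Finset.range (m + 1), f k = f 0 + ∑ k ∈ Finset.Icc 1 m, f k := by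
  rw [Finset.range_eq_Ico, Finset.sum_eq_sum_Ico_succ_bot (Nat.succ_pos m)]
  rfl

theorem mk_elementary_mul_mk_signedComplete :
    PowerSeries.mk elementary * PowerSeries.mk signedComplete = 1 := by
  ext m : 1
  rw [PowerSeries.coeff_mul, PowerSeries.coeff_one]
  simp only [PowerSeries.coeff_mk]
  rw [Finset.Nat.sum_antidiagonal_eq_sum_range_succ (fun i j => elementary i * signedComplete j),
    sum_range_succ_eq_add_sum_Icc]
  split_ifs with h
  · subst h
    simp [elementary_zero, signedComplete_zero]
  · rw [Nat.sub_zero, signedComplete_eq (Nat.pos_of_ne_zero h), elementary_zero]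
    ring

theorem mk_signedPowerSum :
    PowerSeries.mk signedPowerSum =
      PowerSeries.mk (fun k => (k : PowerSeriesRing) * elementary k) *
        PowerSeries.mk signedComplete := by
  ext m : 1
  rw [PowerSeries.coeff_mul]
  simp only [PowerSeries.coeff_mk]
  rw [Finset.Nat.sum_antidiagonal_eq_sum_range_succ
    (fun i j => (i : PowerSeriesRing) * elementary i * signedComplete j),
    sum_range_succ_eq_add_sum_Icc, signedPowerSum_eq]
  simp

/-- In generating functions this is $E\cdot P=tE'$, the source of Newton's identity. -/
theorem mk_elementary_mul_mk_signedPowerSum :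
    PowerSeries.mk elementary * PowerSeries.mk signedPowerSum =
      PowerSeries.mk (fun k => (k : PowerSeriesRing) * elementary k) := by
  rw [mk_signedPowerSum, mul_left_comm, mk_elementary_mul_mk_signedComplete, mul_one]

/-- Newton's identity. -/
theorem natCast_mul_elementary (m : ℕ) :
    (m : PowerSeriesRing) * elementary m =
      ∑ s ∈ Finset.range m, elementary s * signedPowerSum (m - s) := by
  have := congrArg (PowerSeries.coeff m) mk_elementary_mul_mk_signedPowerSum
  rw [PowerSeries.coeff_mul] at this
  simp only [PowerSeries.coeff_mk] at this
  rw [Finset.Nat.sum_antidiagonal_eq_sum_range_succ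
    (fun i j => elementary i * signedPowerSum j), Finset.sum_range_succ, Nat.sub_self,
    signedPowerSum_zero, mul_zero, add_zero] at this
  exact this.symm

/-! ### Power sums -/

open Classical in
/-- The power sum symmetric function `p_m`, for `m ≥ 1`. -/
def powerSum (m : ℕ) : PowerSeriesRing := fun d =>
  if ∃ i, Finsupp.single i m = d then 1 else 0

open Classical in
theorem coeff_powerSum (m : ℕ) (d : ℕ+ →₀ ℕ) :
    MvPowerSeries.coeff d (powerSum m) = if ∃ i, Finsupp.single i m = d then 1 else 0 := rfl

open Classical in
theorem coeff_elementary (m : ℕ) (d : ℕ+ →₀ ℕ) :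
    MvPowerSeries.coeff d (elementary m) = if (∀ i, d i ≤ 1) ∧ d.degree = m then 1 else 0 := by
  change (if _ then _ else _) = _
  refine if_congr ?_ rfl rfl
  constructor
  · rintro ⟨s, rfl, rfl⟩
    refine ⟨fun i => ?_, ?_⟩
    · rw [Finsupp.finsetSum_apply]
      simp only [Finsupp.single_apply, Finset.sum_ite_eq']
      split_ifs <;> omega
    · simp [map_sum]
  · rintro ⟨h, rfl⟩
    have h1 : ∀ i ∈ d.support, d i = 1 := fun i hi =>
      le_antisymm (h i) (Nat.pos_of_ne_zero (Finsupp.mem_support_iff.1 hi))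
    refine ⟨d.support, ?_, ?_⟩
    · rw [Finsupp.degree_apply, Finset.sum_congr rfl h1]
      simp
    · conv_rhs => rw [← Finsupp.sum_single d]
      exact Finset.sum_congr rfl fun i hi => by rw [h1 i hi]

open Classical in
-- A factorization of the monomial $x^d$ is the choice of the variable $x_i$ whose $r$-th power
-- comes from $p_r$. The rest must be squarefree, so $d_i\in\{r,r+1\}$ and all other exponents are
-- at most $1$.
theorem coeff_elementary_mul_powerSum {m r : ℕ} (hr : 0 < r) (hrm : r ≤ m) (d : ℕ+ →₀ ℕ) :
    MvPowerSeries.coeff d (elementary (m - r) * powerSum r) =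
      ∑ i ∈ d.support, if d.degree = m ∧ r ≤ d i ∧ d i ≤ r + 1 ∧ ∀ j, j ≠ i → d j ≤ 1 then 1
        else 0 := by
  rw [MvPowerSeries.coeff_mul, ← Finset.sum_filter_add_sum_filter_not d.support (fun i => r ≤ d i)]
  rw [Finset.sum_eq_zero (s := {i ∈ d.support | ¬ r ≤ d i}), add_zero]
  · symm
    -- Only pairs whose second entry is $r$ times a unit vector have a nonzero $p_r$-coefficient;
    -- $r>0$ makes $i$ recoverable from that vector.
    refine Finset.sum_of_injOn (fun i => (d - Finsupp.single i r, Finsupp.single i r)) ?_ ?_ ?_ ?_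
    · intro i _ j _ h
      exact (Finsupp.single_left_inj hr.ne').1 (Prod.ext_iff.1 h).2
    · intro i hi
      have hi := (Finset.mem_filter.1 hi).2
      refine Finset.mem_coe.2 (Finset.HasAntidiagonal.mem_antidiagonal.2 ?_)
      exact tsub_add_cancel_of_le (Finsupp.single_le_iff.2 hi)
    · rintro ⟨u, v⟩ huv hn
      rw [coeff_powerSum, if_neg, mul_zero]
      rintro ⟨i, rfl⟩
      refine hn ⟨i, ?_, ?_⟩
      · have := Finset.HasAntidiagonal.mem_antidiagonal.1 huv
        have := DFunLike.congr_fun this i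
        simp at this
        simp
        omega
      · have := Finset.HasAntidiagonal.mem_antidiagonal.1 huv
        simp only at this
        simp [← this]
    · intro i hi
      have hi := (Finset.mem_filter.1 hi).2
      change _ = MvPowerSeries.coeff (d - Finsupp.single i r) (elementary (m - r)) *
        MvPowerSeries.coeff (Finsupp.single i r) (powerSum r)
      rw [coeff_powerSum r, if_pos (⟨i, rfl⟩ : ∃ j, Finsupp.single j r = Finsupp.single i r),
        mul_one, coeff_elementary]
      refine if_congr ?_ rfl rfl
      have hd : (d - Finsupp.single i r).degree + r = d.degree := by
        conv_rhs => rw [← tsub_add_cancel_of_le (Finsupp.single_le_iff.2 hi)]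
        rw [map_add]
        simp
      constructor
      · rintro ⟨h₁, h₂, h₃, h₄⟩
        refine ⟨fun j => ?_, by omega⟩
        by_cases hj : j = i
        · subst hj
          simp
          omega
        · have := h₄ j hj
          simp only [Finsupp.tsub_apply]
          omega
      · rintro ⟨h₁, h₂⟩
        refine ⟨by omega, hi, ?_, fun j hj => ?_⟩
        · have := h₁ i
          simp at this
          omega
        · have := h₁ j
          simpa [Finsupp.single_apply, Ne.symm hj] using this
  · intro i hi
    rw [if_neg]
    have := (Finset.mem_filter.1 hi).2
    tauto

/-- Newton's identity for the actual power sums. For a variable $x_i$ of a monomial, only $r=d_i$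
and $r=d_i-1$ can contribute. They cancel when $d_i\ge2$; when $d_i=1$ only $r=1$ is in range. So
each variable of a squarefree monomial of degree $m$ contributes $1$, and all other monomials
cancel. -/
theorem natCast_mul_elementary_eq_sum_powerSum (m : ℕ) :
    (m : PowerSeriesRing) * elementary m =
      ∑ r ∈ Finset.Icc 1 m, elementary (m - r) * ((-1) ^ (r - 1) * powerSum r) := by
  classical
  ext d
  have key : ∀ i ∈ d.support, ∑ r ∈ Finset.Icc 1 m, (-1 : ℤ) ^ (r - 1) *
      (if d.degree = m ∧ r ≤ d i ∧ d i ≤ r + 1 ∧ ∀ j, j ≠ i → d j ≤ 1 then 1 else 0) =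
      if d.degree = m ∧ ∀ j, d j ≤ 1 then 1 else 0 := by
    intro i hi
    have hi0 : 0 < d i := Nat.pos_of_ne_zero (Finsupp.mem_support_iff.1 hi)
    by_cases hd : d.degree = m ∧ ∀ j, j ≠ i → d j ≤ 1
    · have hle : d i ≤ m := hd.1 ▸ Finsupp.le_degree i d
      by_cases h1 : d i = 1
      · rw [if_pos ⟨hd.1, fun j => if hj : j = i then by rw [hj, h1] else hd.2 j hj⟩]
        rw [Finset.sum_eq_single 1]
        · simp [h1, hd.1]
          exact hd.2
        · intro r hr hr1
          rw [if_neg, mul_zero]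
          have := (Finset.mem_Icc.1 hr).1
          omega
        · intro h
          exact absurd (Finset.mem_Icc.2 ⟨le_rfl, by omega⟩) h
      · rw [if_neg (fun h => by have := h.2 i; omega)]
        obtain ⟨t, ht⟩ : ∃ t, d i = t + 2 := ⟨d i - 2, by omega⟩
        rw [Finset.sum_eq_add_of_mem (t + 1) (t + 2) (by simp; omega) (by simp; omega) (by simp)]
        · rw [if_pos ⟨hd.1, by omega, by omega, hd.2⟩, if_pos ⟨hd.1, by omega, by omega, hd.2⟩]
          simp [pow_succ]
        · intro r _ hr
          rw [if_neg, mul_zero]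
          omega
    · rw [if_neg, Finset.sum_eq_zero]
      · intro r _
        rw [if_neg, mul_zero]
        tauto
      · exact fun h => hd ⟨h.1, fun j _ => h.2 j⟩
  have hL : MvPowerSeries.coeff d ((m : PowerSeriesRing) * elementary m) =
      m * MvPowerSeries.coeff d (elementary m) := by
    rw [← nsmul_eq_mul, map_nsmul, nsmul_eq_mul]
  have hR : ∀ r ∈ Finset.Icc 1 m,
      MvPowerSeries.coeff d (elementary (m - r) * ((-1) ^ (r - 1) * powerSum r)) =
      ∑ i ∈ d.support, (-1 : ℤ) ^ (r - 1) *
      (if d.degree = m ∧ r ≤ d i ∧ d i ≤ r + 1 ∧ ∀ j, j ≠ i → d j ≤ 1 then 1 else 0) := by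
    intro r hr
    have hr := Finset.mem_Icc.1 hr
    rw [← Finset.mul_sum, ← coeff_elementary_mul_powerSum hr.1 hr.2, mul_left_comm]
    -- The same sign is taken in the power series ring and in `ℤ`; the mixed cases would give $1=-1$
    -- in the constant coefficient.
    rcases neg_one_pow_eq_or PowerSeriesRing (r - 1) with h | h <;>
    rcases neg_one_pow_eq_or ℤ (r - 1) with h' | h'
    · rw [h, h', one_mul, one_mul]
    · exact absurd (h.symm.trans (by simpa using congrArg (Int.castRingHom PowerSeriesRing) h'))
        (by
          intro h0
          have := congrArg (MvPowerSeries.coeff (0 : ℕ+ →₀ ℕ)) h0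
          simp at this)
    · exact absurd (h.symm.trans (by simpa using congrArg (Int.castRingHom PowerSeriesRing) h'))
        (by
          intro h0
          have := congrArg (MvPowerSeries.coeff (0 : ℕ+ →₀ ℕ)) h0
          simp at this)
    · rw [h, h', neg_one_mul, neg_one_mul, map_neg]
  rw [hL, map_sum, Finset.sum_congr rfl hR, Finset.sum_comm, Finset.sum_congr rfl key,
    coeff_elementary, Finset.sum_const, nsmul_eq_mul]
  by_cases h : d.degree = m ∧ ∀ j, d j ≤ 1
  · rw [if_pos h, if_pos h.symm, ← h.1, Finsupp.degree_apply, Finset.sum_congr rfl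
      (fun i hi => le_antisymm (h.2 i) (Nat.pos_of_ne_zero (Finsupp.mem_support_iff.1 hi)))]
    simp
  · rw [if_neg h, if_neg (fun h' => h h'.symm), mul_zero, mul_zero]

/-- Both sides satisfy Newton's recursion, and the term $s=0$ has coefficient $e_0=1$, so the
recursion determines them. -/
theorem signedPowerSum_eq_powerSum {m : ℕ} (hm : 0 < m) :
    signedPowerSum m = (-1) ^ (m - 1) * powerSum m := by
  induction m using Nat.strong_induction_on with
  | _ m ih =>
    have h₁ := natCast_mul_elementary m
    have h₂ := natCast_mul_elementary_eq_sum_powerSum m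
    obtain ⟨t, rfl⟩ : ∃ t, m = t + 1 := ⟨m - 1, by omega⟩
    have h₃ : ∑ r ∈ Finset.Icc 1 (t + 1), elementary (t + 1 - r) * ((-1) ^ (r - 1) * powerSum r) =
        ∑ s ∈ Finset.range (t + 1), elementary s *
          ((-1) ^ (t + 1 - s - 1) * powerSum (t + 1 - s)) := by
      refine Finset.sum_nbij' (fun r => t + 1 - r) (fun s => t + 1 - s) ?_ ?_ ?_ ?_ ?_
      · intro r hr; simp at hr ⊢; omega
      · intro r hr; simp at hr ⊢; omega
      · intro r hr; simp at hr ⊢; omega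
      · intro r hr; simp at hr ⊢; omega
      · intro r hr
        simp only [Finset.mem_Icc] at hr
        rw [show t + 1 - (t + 1 - r) = r by omega]
    rw [h₃, h₁, Finset.sum_range_succ', Finset.sum_range_succ'] at h₂
    rw [Finset.sum_congr rfl (fun s hs => by
      rw [ih (t + 1 - (s + 1)) (by omega) (by have := Finset.mem_range.1 hs; omega)])] at h₂
    simpa [elementary_zero] using h₂

/-- The coefficients of a product of power sums count colourings. -/
theorem coeff_prod_powerSum {I : Type*} [Fintype I] (s : I → ℕ) (hs : ∀ i, 0 < s i)
    (d : ℕ+ →₀ ℕ) :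
    MvPowerSeries.coeff d (∏ i, powerSum (s i)) =
      (Nat.card {f : I → ℕ+ // ∑ i, Finsupp.single (f i) (s i) = d} : ℤ) := by
  classical
  rw [MvPowerSeries.coeff_prod]
  simp only [coeff_powerSum]
  simp_rw [Finset.prod_ite_zero, Finset.prod_const_one]
  rw [Finset.sum_boole, Nat.cast_inj, ← Nat.card_eq_finsetCard]
  symm
  -- A nonzero term of the product picks a monomial $x_{f(i)}^{s_i}$ from each factor; $s_i>0$ makes
  -- $f(i)$ unique.
  refine Nat.card_eq_of_bijective (fun f => ⟨Finsupp.equivFunOnFinite.symm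
    (fun i => Finsupp.single (f.1 i) (s i)), ?_⟩) ⟨?_, ?_⟩
  · refine Finset.mem_filter.2 ⟨?_, fun i _ => ⟨f.1 i, rfl⟩⟩
    rw [Finset.mem_finsuppAntidiag]
    exact ⟨f.2, Finset.subset_univ _⟩
  · intro f f' h
    refine Subtype.ext (funext fun i => ?_)
    have := DFunLike.congr_fun (Subtype.ext_iff.1 h) i
    exact (Finsupp.single_left_inj (hs i).ne').1 this
  · rintro ⟨l, hl⟩
    obtain ⟨h₁, h₂⟩ := Finset.mem_filter.1 hl
    rw [Finset.mem_finsuppAntidiag] at h₁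
    choose f hf using fun i => h₂ i (Finset.mem_univ i)
    refine ⟨⟨f, ?_⟩, ?_⟩
    · rw [← h₁.1]
      exact Finset.sum_congr rfl fun i _ => hf i
    · refine Subtype.ext (Finsupp.ext fun i => ?_)
      exact hf i

/-! ### The contribution of a tree -/

/-- The data that turn a tree with `m` vertices into a tree triple: a composition of `m`, and an
integer `r`, shifted by one, that is smaller than the first part. -/
abbrev TripleData (m : ℕ) : Type := Σ α : Composition m, Fin (α.blocks.headD 0)

open Classical in
/-- The contribution of a tree with `m` vertices to the entry `(i, j)` of the forest triple matrix,
where `a` tells whether the tree contains the first vertex of the graph, and `b` whether it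
contains the path. -/
def tripleWeight (i j : ℕ) (a b : Prop) {m : ℕ} (x : TripleData m) : PowerSeriesRing :=
  if (a → x.1.blocks.headD 0 = i ∧ x.2.val = 0) ∧ (b → j ≤ x.1.blocks.getLastD 0) then
    (-1) ^ (x.1.blocks.length - 1) *
      elementaryProd ((if a then x.1.blocks.tail else x.1.blocks : List ℕ) : Multiset ℕ)
  else 0

/-- The total contribution of the tree triples on a fixed tree with `m` vertices. -/
def treeWeight (i j : ℕ) (a b : Prop) (m : ℕ) : PowerSeriesRing :=
  ∑ x : TripleData m, tripleWeight i j a b x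

/-- The free choice of $r$ supplies the factor $\alpha_1$. -/
theorem treeWeight_of_not_of_not (i j : ℕ) {a b : Prop} (ha : ¬ a) (hb : ¬ b) (m : ℕ) :
    treeWeight i j a b m = signedPowerSum m := by
  rw [treeWeight, Fintype.sum_sigma, signedPowerSum, ← sum_composition]
  refine Finset.sum_congr rfl fun α _ => ?_
  simp only [tripleWeight, ha, hb, false_imp_iff, and_self, if_true, if_false, Finset.sum_const,
    Finset.card_univ, Fintype.card_fin, nsmul_eq_mul]
  ring

open Classical in
theorem treeWeight_of_not (i j : ℕ) {a b : Prop} (ha : ¬ a) (hb : b) (m : ℕ) :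
    treeWeight i j a b m = ∑ l ∈ compositionLists m, if j ≤ l.getLastD 0 then
      (-1) ^ (l.length - 1) * (l.headD 0 : PowerSeriesRing) * elementaryProd l else 0 := by
  rw [treeWeight, Fintype.sum_sigma, ← sum_composition]
  refine Finset.sum_congr rfl fun α _ => ?_
  simp only [tripleWeight, ha, hb, false_imp_iff, true_and, true_imp_iff, if_false,
    Finset.sum_const, Finset.card_univ, Fintype.card_fin, nsmul_eq_mul]
  split_ifs
  · ring
  · ring

open Classical in
-- Fixing $r=1$ removes the factor $\alpha_1$, and the reduced type drops the first part $i$, so the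
-- sum runs over the tails `l`. The last part is taken in `i :: l` because it is $i$ itself when the
-- tail is empty.
theorem treeWeight_of_mem {i j : ℕ} (hi : 0 < i) {a b : Prop} (ha : a) (m : ℕ) :
    treeWeight i j a b m = if i ≤ m then
      ∑ l ∈ compositionLists (m - i), if b → j ≤ (i :: l).getLastD 0 then
        (-1) ^ l.length * elementaryProd l else 0 else 0 := by
  have h : treeWeight i j a b m = ∑ l ∈ compositionLists m,
      if l.headD 0 = i then (if b → j ≤ l.getLastD 0 then
        (-1) ^ (l.length - 1) * elementaryProd (l.tail : List ℕ) else 0) else 0 := by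
    rw [treeWeight, Fintype.sum_sigma, ← sum_composition]
    refine Finset.sum_congr rfl fun α _ => ?_
    simp only [tripleWeight, ha, true_imp_iff, if_true]
    by_cases h : α.blocks.headD 0 = i
    · rw [Finset.sum_eq_single (⟨0, by omega⟩ : Fin (α.blocks.headD 0))]
      · rw [if_pos h]
        simp only [h, and_self, true_and]
      · intro x _ hx
        rw [if_neg]
        rintro ⟨⟨-, h0⟩, -⟩
        exact hx (Fin.ext h0)
      · simp
    · simp only [h, false_and, if_false, Finset.sum_const_zero]
  rw [h]
  rcases Nat.eq_zero_or_pos m with rfl | hm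
  · rw [if_neg (by omega), compositionLists_zero, Finset.sum_singleton, if_neg]
    simp
    omega
  rw [sum_compositionLists_cons hm]
  split_ifs with him
  · rw [Finset.sum_eq_single i]
    · simp
    · intro k _ hk
      refine Finset.sum_eq_zero fun l _ => ?_
      rw [if_neg]
      simpa using hk
    · intro h
      exact absurd (Finset.mem_Icc.2 ⟨hi, him⟩) h
  · refine Finset.sum_eq_zero fun k hk => Finset.sum_eq_zero fun l _ => ?_
    rw [if_neg]
    have := (Finset.mem_Icc.1 hk).2
    simp
    omega

theorem treeWeight_of_mem_of_not {i j : ℕ} (hi : 0 < i) {a b : Prop} (ha : a) (hb : ¬ b) (m : ℕ) :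
    treeWeight i j a b m = if i ≤ m then signedComplete (m - i) else 0 := by
  rw [treeWeight_of_mem hi ha]
  simp [hb, signedComplete]

/-- Removing a last part $s<m$ leaves $-e_s$ times a signed power sum, while $s=m$ gives $me_m$.
Expanding $me_m$ by Newton's identity cancels all the terms with $s>k$ and leaves the short sum
$s\le k$. -/
theorem treeWeight_of_not_of_mem {i k m : ℕ} {a b : Prop} (ha : ¬ a) (hb : b) (hkm : k + 1 ≤ m) :
    treeWeight i (k + 1) a b m =
      ∑ s ∈ Finset.range (k + 1), elementary s * signedPowerSum (m - s) := by
  classical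
  rw [treeWeight_of_not i (k + 1) ha hb, sum_compositionLists_concat (by omega)]
  have h : ∀ s ∈ Finset.Icc 1 m, (∑ l ∈ compositionLists (m - s),
      if k + 1 ≤ (l ++ [s]).getLastD 0 then (-1) ^ ((l ++ [s]).length - 1) *
        ((l ++ [s]).headD 0 : PowerSeriesRing) * elementaryProd ((l ++ [s] : List ℕ)) else 0) =
      -- At $s=m$ the subtracted term vanishes, since `signedPowerSum 0 = 0`, so one formula covers
      -- both cases.
      if k + 1 ≤ s then (if s = m then (m : PowerSeriesRing) * elementary m else 0) -
        elementary s * signedPowerSum (m - s) else 0 := by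
    intro s hs
    have hs := Finset.mem_Icc.1 hs
    simp only [List.getLastD_concat]
    split_ifs with h₁ h₂
    · subst h₂
      simp [compositionLists_zero, signedPowerSum_zero, elementaryProd]
    · rw [signedPowerSum, Finset.mul_sum, zero_sub, ← Finset.sum_neg_distrib]
      refine Finset.sum_congr rfl fun l hl => ?_
      rw [elementaryProd_concat]
      cases l with
      | nil =>
        have := (mem_compositionLists.1 hl).2
        simp at this
        omega
      | cons c l =>
        simp [pow_succ]
        ring
    · simp
  rw [Finset.sum_congr rfl h, ← Finset.sum_filter]
  have hf : Finset.filter (fun s => k + 1 ≤ s) (Finset.Icc 1 m) = Finset.Ico (k + 1) (m + 1) := by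
    ext s
    simp
    omega
  rw [hf, Finset.sum_sub_distrib, Finset.sum_ite_eq', if_pos (by simp; omega),
    natCast_mul_elementary, Finset.sum_Ico_succ_top hkm, Nat.sub_self, signedPowerSum_zero,
    mul_zero, add_zero, ← Finset.sum_range_add_sum_Ico _ hkm, add_sub_cancel_right]

/-- After the first part $k+1$ a composition of $c>0$ remains. It is nonempty, so its last part $s$
is the last part of the whole, and the condition becomes $s>k$. -/
theorem treeWeight_of_mem_of_mem {k c : ℕ} {a b : Prop} (ha : a) (hb : b) (hc : 0 < c) :
    treeWeight (k + 1) (k + 1) a b (k + 1 + c) =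
      -∑ s ∈ Finset.Icc 1 c, if k < s then elementary s * signedComplete (c - s) else 0 := by
  classical
  rw [treeWeight_of_mem k.succ_pos ha, if_pos (by omega), Nat.add_sub_cancel_left,
    sum_compositionLists_concat hc, ← Finset.sum_neg_distrib]
  refine Finset.sum_congr rfl fun s _ => ?_
  simp only [hb, true_imp_iff]
  have : ∀ l : List ℕ, ((k + 1) :: (l ++ [s])).getLastD 0 = s := by
    intro l
    rw [← List.cons_append, List.getLastD_concat]
  simp only [this, Nat.succ_le_iff]
  split_ifs with h
  · rw [signedComplete, Finset.mul_sum, ← Finset.sum_neg_distrib]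
    refine Finset.sum_congr rfl fun l _ => ?_
    rw [elementaryProd_concat, List.length_append, List.length_singleton, pow_succ]
    ring
  · simp

/-- The first factor is a coefficient of $1/E$ and the second a coefficient of $E\cdot\sum_u$
`signedPowerSum (b + u)` $t^u$. The sum over $k$ is the coefficient of $t^{a-1}$ in their product,
where $E$ cancels. -/
theorem sum_treeWeight_mul_treeWeight {a b N : ℕ} (ha : 0 < a) (hb : 0 < b) (hN : a ≤ N)
    {A₁ B₁ A₂ B₂ : Prop} (hA₁ : A₁) (hB₁ : ¬ B₁) (hA₂ : ¬ A₂) (hB₂ : B₂) :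
    ∑ k ∈ Finset.range N, treeWeight (k + 1) (k + 1) A₁ B₁ a *
      treeWeight (k + 1) (k + 1) A₂ B₂ (b + k) = signedPowerSum (a + b - 1) := by
  have h : PowerSeries.mk elementary * PowerSeries.mk (fun u => signedPowerSum (b + u)) *
      PowerSeries.mk signedComplete = PowerSeries.mk (fun u => signedPowerSum (b + u)) := by
    rw [mul_right_comm, mk_elementary_mul_mk_signedComplete, one_mul]
  have h := congrArg (PowerSeries.coeff (a - 1)) h
  rw [PowerSeries.coeff_mul, PowerSeries.coeff_mk, Finset.Nat.sum_antidiagonal_eq_sum_range_succ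
    (fun i j => PowerSeries.coeff i (PowerSeries.mk elementary *
      PowerSeries.mk (fun u => signedPowerSum (b + u))) *
      PowerSeries.coeff j (PowerSeries.mk signedComplete)), show (a - 1).succ = a by omega] at h
  rw [show a + b - 1 = b + (a - 1) by omega, ← h]
  symm
  refine Finset.sum_subset_zero_on_sdiff (by simpa using hN) ?_ ?_
  · intro k hk
    rw [treeWeight_of_mem_of_not k.succ_pos hA₁ hB₁, if_neg, zero_mul]
    simp at hk
    omega
  · intro k hk
    have hk := Finset.mem_range.1 hk
    rw [treeWeight_of_mem_of_not k.succ_pos hA₁ hB₁, if_pos (by omega),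
      treeWeight_of_not_of_mem hA₂ hB₂ (by omega), mul_comm, PowerSeries.coeff_mul,
      PowerSeries.coeff_mk]
    congr 1
    · congr 1
      omega
    · simp only [PowerSeries.coeff_mk]
      rw [Finset.Nat.sum_antidiagonal_eq_sum_range_succ
        (fun i j => elementary i * signedPowerSum (b + j))]
      refine Finset.sum_congr rfl fun s hs => ?_
      have := Finset.mem_range.1 hs
      rw [show b + k - s = b + (k - s) by omega]

/-- After exchanging the sums, the term with last part $s$ occurs for exactly the $s$ values $k<s$.
The factor $s$ turns the sum into `signedPowerSum_eq`. -/
theorem sum_treeWeight {c N : ℕ} (hc : 0 < c) (hN : c ≤ N) {A B : Prop} (hA : A) (hB : B) :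
    ∑ k ∈ Finset.range N, treeWeight (k + 1) (k + 1) A B (k + 1 + c) = -signedPowerSum c := by
  rw [Finset.sum_congr rfl fun k _ => treeWeight_of_mem_of_mem hA hB hc, Finset.sum_neg_distrib,
    Finset.sum_comm, signedPowerSum_eq]
  congr 1
  refine Finset.sum_congr rfl fun s hs => ?_
  have hs := Finset.mem_Icc.1 hs
  rw [← Finset.sum_filter, Finset.sum_const, show Finset.filter (fun k => k < s) (Finset.range N) =
    Finset.range s by ext; simp; omega, Finset.card_range, nsmul_eq_mul, mul_assoc]

/-! ### Connected components of edge sets -/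

/-- The partition of the vertices into the connected components of the graph with edge set `S`. -/
def componentSetoid {V : Type*} (S : Set (Sym2 V)) : Setoid V :=
  (SimpleGraph.fromEdgeSet S).reachableSetoid

/-- To be related by the partition into components is the smallest equivalence relation that
relates the ends of every edge. -/
theorem componentSetoid_le_iff {V : Type*} {S : Set (Sym2 V)} {r : Setoid V} :
    componentSetoid S ≤ r ↔ ∀ a b, s(a, b) ∈ S → r a b := by
  constructor
  · intro h a b hab
    by_cases hne : a = b
    · subst hne
      exact r.refl a
    · exact h (SimpleGraph.Adj.reachable ((SimpleGraph.fromEdgeSet_adj S).2 ⟨hab, hne⟩))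
  · rintro h a b ⟨p⟩
    induction p with
    | nil => exact r.refl _
    | cons hadj _ ih => exact r.trans (h _ _ ((SimpleGraph.fromEdgeSet_adj S).1 hadj).1) ih

theorem componentSetoid_of_mem {V : Type*} {S : Set (Sym2 V)} {a b : V} (h : s(a, b) ∈ S) :
    componentSetoid S a b :=
  componentSetoid_le_iff.1 le_rfl a b h

theorem componentSetoid_mono {V : Type*} {S T : Set (Sym2 V)} (h : S ⊆ T) :
    componentSetoid S ≤ componentSetoid T :=
  componentSetoid_le_iff.2 fun _ _ hab => componentSetoid_of_mem (h hab)

theorem componentSetoid_diff_singleton {V : Type*} {S : Set (Sym2 V)} {u v : V}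
    (h : componentSetoid (S \ {s(u, v)}) u v) :
    componentSetoid (S \ {s(u, v)}) = componentSetoid S := by
  refine le_antisymm (componentSetoid_mono Set.sdiff_subset) (componentSetoid_le_iff.2 ?_)
  intro a b hab
  by_cases he : s(a, b) = s(u, v)
  · rcases Sym2.eq_iff.1 he with ⟨rfl, rfl⟩ | ⟨rfl, rfl⟩
    · exact h
    · exact Setoid.symm' _ h
  · exact componentSetoid_of_mem ⟨hab, he⟩

theorem componentSetoid_congr_of_diff_singleton {V : Type*} {S T : Set (Sym2 V)} {u v : V}
    (hST : S \ {s(u, v)} = T \ {s(u, v)}) (h : componentSetoid (S \ {s(u, v)}) u v) :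
    componentSetoid S = componentSetoid T := by
  rw [← componentSetoid_diff_singleton h, hST]
  rw [hST] at h
  exact componentSetoid_diff_singleton h

/-! ### Whitney's broken circuit theorem -/

section Whitney

variable {N : ℕ} {G : SimpleGraph (Fin N)}

/-- The edges of `S` that are smaller than `e`. -/
def edgesBelow (o : LinearOrder G.edgeSet) (S : Set (Sym2 (Fin N))) (e : G.edgeSet) :
    Set (Sym2 (Fin N)) :=
  {f | f ∈ S ∧ ∃ h : f ∈ G.edgeSet, o.lt ⟨f, h⟩ e}

/-- The edges of `G` whose ends are connected by smaller edges of `S`. -/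
def activeEdges (o : LinearOrder G.edgeSet) (S : Set (Sym2 (Fin N))) : Set G.edgeSet :=
  {e | ∃ u v, e.val = s(u, v) ∧ componentSetoid (edgesBelow o S e) u v}

theorem edgesBelow_subset (o : LinearOrder G.edgeSet) (S : Set (Sym2 (Fin N))) (e : G.edgeSet) :
    edgesBelow o S e ⊆ S \ {e.val} := by
  rintro f ⟨hf, h, hlt⟩
  refine ⟨hf, ?_⟩
  rintro rfl
  exact (@lt_irrefl _ o.toPreorder _) hlt

/-- The ends of an active edge are already joined by other edges of `S`, so inserting or deleting it
does not affect the components. -/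
theorem componentSetoid_eq_of_mem_activeEdges {o : LinearOrder G.edgeSet}
    {S T : Set (Sym2 (Fin N))} {e : G.edgeSet} (he : e ∈ activeEdges o S)
    (hST : S \ {e.val} = T \ {e.val}) : componentSetoid S = componentSetoid T := by
  obtain ⟨u, v, huv, h⟩ := he
  have hs := edgesBelow_subset o S e
  rw [huv] at hST hs
  exact componentSetoid_congr_of_diff_singleton hST (componentSetoid_mono hs h)

/-- Toggling an active edge `e` keeps all edges active or inactive. For `e'` above `e`, the edges
below `e` that join the ends of `e` are also available; for any other `e'`, `e` is not among the
edges below it. -/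
theorem activeEdges_eq_of_mem_activeEdges {o : LinearOrder G.edgeSet}
    {S T : Set (Sym2 (Fin N))} {e : G.edgeSet} (he : e ∈ activeEdges o S)
    (hST : S \ {e.val} = T \ {e.val}) : activeEdges o S = activeEdges o T := by
  have hiff : ∀ f, f ≠ e.val → (f ∈ S ↔ f ∈ T) := fun f hf => by
    have := Set.ext_iff.1 hST f
    simpa [hf] using this
  have key : ∀ e', componentSetoid (edgesBelow o S e') = componentSetoid (edgesBelow o T e') := by
    intro e'
    by_cases hlt : o.lt e e'
    · obtain ⟨u, v, huv, h⟩ := he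
      refine componentSetoid_congr_of_diff_singleton (u := u) (v := v) ?_ ?_
      · ext f
        by_cases hf : f = e.val
        · simp [huv ▸ hf]
        · have := hiff f hf
          simp only [edgesBelow, Set.mem_sdiff, Set.mem_ofPred_eq, this]
      · refine componentSetoid_mono ?_ h
        rintro f ⟨hf, hf', hfe⟩
        refine ⟨⟨hf, hf', (@lt_trans _ o.toPreorder _ _ _) hfe hlt⟩, ?_⟩
        have := (edgesBelow_subset o S e ⟨hf, hf', hfe⟩).2
        rwa [huv] at this
    · congr 1
      ext f
      by_cases hf : f = e.val
      · subst hf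
        simp only [edgesBelow, Set.mem_ofPred_eq]
        constructor
        · rintro ⟨-, _, h⟩
          exact absurd h hlt
        · rintro ⟨-, _, h⟩
          exact absurd h hlt
      · simp only [edgesBelow, Set.mem_ofPred_eq, hiff f hf]
  ext e'
  change (∃ u v, _ ∧ _) ↔ (∃ u v, _ ∧ _)
  rw [key e']

/-- The edge set `S` contains no broken circuit. -/
def NoBrokenCircuit (G : SimpleGraph (Fin N)) (o : LinearOrder G.edgeSet)
    (S : Set (Sym2 (Fin N))) : Prop :=
  ∀ B, IsBrokenCircuit G o B → ¬ B ⊆ S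

/-- A path of smaller edges of `S` between the ends of `e` closes up to a cycle with maximum `e`;
conversely a broken circuit in `S` is such a path for the maximal edge of its cycle. -/
theorem noBrokenCircuit_iff {o : LinearOrder G.edgeSet} {S : Set (Sym2 (Fin N))} :
    NoBrokenCircuit G o S ↔ activeEdges o S = ∅ := by
  rw [Set.eq_empty_iff_forall_notMem]
  constructor
  · rintro h e ⟨u, v, huv, hr⟩
    set K := SimpleGraph.fromEdgeSet (insert e.val (edgesBelow o S e)) with hK
    have hadj : G.Adj u v := by
      have := e.2
      rwa [huv] at this
    have hKe : K.Adj u v ∧ (K \ SimpleGraph.fromEdgeSet {s(u, v)}).Reachable u v := by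
      refine ⟨(SimpleGraph.fromEdgeSet_adj _).2 ⟨by simp [huv], hadj.ne⟩, ?_⟩
      refine SimpleGraph.Reachable.mono ?_ hr
      intro a b hab
      rw [SimpleGraph.fromEdgeSet_adj] at hab
      simp only [hK, SimpleGraph.sdiff_adj, SimpleGraph.fromEdgeSet_adj, Set.mem_insert_iff]
      refine ⟨⟨Or.inr hab.1, hab.2⟩, fun h' => ?_⟩
      have := (edgesBelow_subset o S e hab.1).2
      rw [huv] at this
      exact this h'.1
    obtain ⟨w, c, hc, hec⟩ := SimpleGraph.adj_and_reachable_delete_edges_iff_exists_cycle.1 hKe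
    have hcK : ∀ f ∈ c.edges, f = e.val ∨ f ∈ edgesBelow o S e := fun f hf => by
      have := c.edges_subset_edgeSet hf
      rw [hK, SimpleGraph.edgeSet_fromEdgeSet] at this
      exact this.1
    have hcG : ∀ f ∈ c.edges, f ∈ G.edgeSet := fun f hf => by
      rcases hcK f hf with rfl | ⟨-, h, -⟩
      · exact e.2
      · exact h
    refine h ({f | f ∈ c.edges} \ {e.val}) ⟨w, c.transfer G hcG, e, hc.transfer hcG, ?_, ?_, ?_⟩ ?_
    · rwa [SimpleGraph.Walk.edges_transfer, huv]
    · intro f hf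
      rw [SimpleGraph.Walk.edges_transfer] at hf
      rcases hcK f hf with h | ⟨-, h, hlt⟩
      · rw [Subtype.ext h]
        exact o.le_refl e
      · exact (@le_of_lt _ o.toPreorder _ _) hlt
    · rw [SimpleGraph.Walk.edges_transfer]
    · rintro f ⟨hf, hfe⟩
      exact ((hcK f hf).resolve_left hfe).1
  · rintro h B ⟨w, c, e, hc, hec, hmax, rfl⟩ hS
    refine h e ?_
    obtain ⟨⟨u, v⟩, huv⟩ : ∃ p : Fin N × Fin N, e.val = s(p.1, p.2) := ⟨_, (Quot.out_eq e.val).symm⟩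
    refine ⟨u, v, huv, ?_⟩
    set K := SimpleGraph.fromEdgeSet {f | f ∈ c.edges} with hK
    have hcK : ∀ f ∈ c.edges, f ∈ K.edgeSet := fun f hf => by
      rw [hK, SimpleGraph.edgeSet_fromEdgeSet]
      exact ⟨hf, G.not_isDiag_of_mem_edgeSet (c.edges_subset_edgeSet hf)⟩
    have := (SimpleGraph.adj_and_reachable_delete_edges_iff_exists_cycle (v := u) (w := v)).2
      ⟨w, c.transfer K hcK, hc.transfer hcK, by
        rw [SimpleGraph.Walk.edges_transfer, ← huv]
        exact hec⟩
    refine SimpleGraph.Reachable.mono ?_ this.2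
    intro a b hab
    rw [hK, SimpleGraph.deleteEdges_adj, SimpleGraph.fromEdgeSet_adj] at hab
    have hne : s(a, b) ≠ e.val := fun h' => hab.2 (h'.trans huv)
    have hG := c.edges_subset_edgeSet hab.1.1
    refine (SimpleGraph.fromEdgeSet_adj _).2 ⟨⟨hS ⟨hab.1.1, hne⟩, hG, ?_⟩, hab.1.2⟩
    exact (@lt_of_le_of_ne _ o.toPartialOrder _ _) (hmax ⟨_, hG⟩ hab.1.1)
      (fun h' => hne (Subtype.ext_iff.1 h'))

theorem NoBrokenCircuit.isAcyclic {o : LinearOrder G.edgeSet} {S : Set (Sym2 (Fin N))}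
    (h : NoBrokenCircuit G o S) (hS : S ⊆ G.edgeSet) :
    (SimpleGraph.fromEdgeSet S).IsAcyclic := by
  intro w c hc
  have hcS : ∀ f ∈ c.edges, f ∈ S := fun f hf => by
    have := c.edges_subset_edgeSet hf
    rw [SimpleGraph.edgeSet_fromEdgeSet] at this
    exact this.1
  have hcG : ∀ f ∈ c.edges, f ∈ G.edgeSet := fun f hf => hS (hcS f hf)
  have hfin : {f : G.edgeSet | f.val ∈ c.edges}.Finite := Set.toFinite _
  have hne : {f : G.edgeSet | f.val ∈ c.edges}.Nonempty := by
    obtain ⟨f, hf⟩ := List.exists_mem_of_length_pos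
      (show 0 < c.edges.length by
        rw [SimpleGraph.Walk.length_edges]; have := hc.three_le_length; omega)
    exact ⟨⟨f, hcG f hf⟩, hf⟩
  obtain ⟨e, he, hmax⟩ := @Set.exists_max_image _ _ o _ id hfin hne
  refine h ({f | f ∈ c.edges} \ {e.val}) ⟨w, c.transfer G hcG, e, hc.transfer hcG, ?_, ?_, ?_⟩ ?_
  · rwa [SimpleGraph.Walk.edges_transfer]
  · intro f hf
    rw [SimpleGraph.Walk.edges_transfer] at hf
    exact hmax f hf
  · rw [SimpleGraph.Walk.edges_transfer]
  · exact fun f hf => hcS f hf.1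

/-- The edges of a finite graph. -/
def edges {V : Type*} [Finite V] (G : SimpleGraph V) : Finset (Sym2 V) :=
  G.edgeSet.toFinite.toFinset

theorem mem_edges {V : Type*} [Finite V] {G : SimpleGraph V} {e : Sym2 V} :
    e ∈ edges G ↔ e ∈ G.edgeSet :=
  Set.Finite.mem_toFinset _

theorem coe_subset_edgeSet {V : Type*} [Finite V] {G : SimpleGraph V} {S : Finset (Sym2 V)}
    (h : S ⊆ edges G) : (S : Set (Sym2 V)) ⊆ G.edgeSet :=
  fun _ he => mem_edges.1 (h he)

open Classical in
/-- The edge sets without broken circuits. -/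
def noBrokenCircuitSets (G : SimpleGraph (Fin N)) (o : LinearOrder G.edgeSet) :
    Finset (Finset (Sym2 (Fin N))) :=
  (edges G).powerset.filter fun S => NoBrokenCircuit G o (S : Set (Sym2 (Fin N)))

theorem mem_noBrokenCircuitSets {o : LinearOrder G.edgeSet} {S : Finset (Sym2 (Fin N))} :
    S ∈ noBrokenCircuitSets G o ↔
      S ⊆ edges G ∧ NoBrokenCircuit G o (S : Set (Sym2 (Fin N))) := by
  simp [noBrokenCircuitSets]

open Classical in
/-- Whitney's broken circuit theorem, for sums of functions of the partition into components. -/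
theorem sum_powerset_eq_sum_noBrokenCircuit {R : Type*} [CommRing R] (o : LinearOrder G.edgeSet)
    (φ : Setoid (Fin N) → R) :
    ∑ S ∈ (edges G).powerset, (-1) ^ S.card * φ (componentSetoid S) =
      ∑ S ∈ noBrokenCircuitSets G o, (-1) ^ S.card * φ (componentSetoid S) := by
  rw [← Finset.sum_filter_add_sum_filter_not _
    (fun S : Finset (Sym2 (Fin N)) => NoBrokenCircuit G o S)]
  rw [noBrokenCircuitSets, add_eq_left]
  have hact : ∀ S ∈ (edges G).powerset.filter
      (fun S : Finset (Sym2 (Fin N)) => ¬ NoBrokenCircuit G o S),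
      (activeEdges o (S : Set (Sym2 (Fin N)))).Nonempty := by
    intro S hS
    have := (Finset.mem_filter.1 hS).2
    rwa [noBrokenCircuit_iff, ← Ne, ← Set.nonempty_iff_ne_empty] at this
  have hdiff : ∀ (S : Finset (Sym2 (Fin N))) (e : Sym2 (Fin N)),
      (S : Set (Sym2 (Fin N))) \ {e} =
        ((symmDiff S {e} : Finset _) : Set (Sym2 (Fin N))) \ {e} := by
    intro S e
    ext f
    by_cases hf : f = e <;> simp [hf]
  have hA : ∀ (S : Finset (Sym2 (Fin N))) (hS), activeEdges o (S : Set (Sym2 (Fin N))) =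
      activeEdges o ((symmDiff S {(hact S hS).some.val} : Finset _) : Set (Sym2 (Fin N))) :=
    fun S hS => activeEdges_eq_of_mem_activeEdges (hact S hS).some_mem (hdiff _ _)
  -- The chosen active edge depends only on the set of active edges, which toggling preserves. Hence
  -- toggling twice uses the same edge, and the map is a sign-reversing involution.
  have hsome : ∀ (A B : Set G.edgeSet) (hA : A.Nonempty) (hB : B.Nonempty), A = B →
      hA.some = hB.some := by
    rintro A _ hA hB rfl
    rfl
  refine Finset.sum_involution (fun S hS => symmDiff S {(hact S hS).some.val}) ?_ ?_ ?_ ?_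
  · intro S hS
    rw [← componentSetoid_eq_of_mem_activeEdges (hact S hS).some_mem (hdiff _ _)]
    set e := (hact S hS).some.val
    by_cases he : e ∈ S
    · have : symmDiff S {e} = S.erase e := by
        ext f; by_cases hf : f = e <;> simp [Finset.mem_symmDiff, hf, he]
      rw [this, ← Finset.card_erase_add_one he, pow_succ]
      ring
    · have : symmDiff S {e} = insert e S := by
        ext f; by_cases hf : f = e <;> simp [Finset.mem_symmDiff, hf, he]
      rw [this, Finset.card_insert_of_notMem he, pow_succ]
      ring
  · intro S hS _ heq
    have := congrArg (fun T => (hact S hS).some.val ∈ T) heq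
    simp [Finset.mem_symmDiff] at this
  · intro S hS
    have hS' := hS
    rw [Finset.mem_filter, Finset.mem_powerset, noBrokenCircuit_iff] at hS' ⊢
    rw [← hA S hS]
    refine ⟨?_, hS'.2⟩
    intro f hf
    rcases Finset.mem_symmDiff.1 hf with h | h
    · exact hS'.1 h.1
    · rw [Finset.mem_singleton.1 h.1]
      exact mem_edges.2 (hact S hS).some.2
  · intro S hS
    have h := hsome _ _ (hA S hS ▸ hact S hS) (hact S hS) (hA S hS).symm
    change symmDiff (symmDiff S {(hact S hS).some.val})
      {((hA S hS ▸ hact S hS : (activeEdges o _).Nonempty).some).val} = S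
    rw [h, symmDiff_symmDiff_cancel_right]

end Whitney

section Decorations

variable {N : ℕ} {G : SimpleGraph (Fin N)} {o : LinearOrder G.edgeSet}

/-! ### Forest triples as decorated edge sets -/

/-- The number of elements of an equivalence class. -/
def classSize {V : Type*} {r : Setoid V} (C : Quotient r) : ℕ := {v | Quotient.mk r v = C}.ncard

/-- The component `C` of the edge set `S`, as a subgraph. -/
def componentTree (S : Set (Sym2 (Fin N))) (hS : S ⊆ G.edgeSet)
    (C : Quotient (componentSetoid S)) : G.Subgraph where
  verts := {v | Quotient.mk _ v = C}
  Adj a b := s(a, b) ∈ S ∧ Quotient.mk (componentSetoid S) a = C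
  adj_sub h := hS h.1
  edge_vert h := h.2
  symm := ⟨fun a b h => ⟨Sym2.eq_swap (a := a) (b := b) ▸ h.1,
    (Quotient.sound (componentSetoid_of_mem h.1)).symm.trans h.2⟩⟩

theorem componentTree_isTree {S : Set (Sym2 (Fin N))} (hS : S ⊆ G.edgeSet)
    (hac : (SimpleGraph.fromEdgeSet S).IsAcyclic) (C : Quotient (componentSetoid S)) :
    (componentTree S hS C).coe.IsTree := by
  refine ⟨?_, ?_⟩
  · have hne : Nonempty (componentTree S hS C).verts := by
      obtain ⟨v, hv⟩ := Quotient.exists_rep C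
      exact ⟨⟨v, hv⟩⟩
    refine SimpleGraph.Connected.mk ?_
    rintro ⟨a, ha⟩ ⟨b, hb⟩
    have hab : componentSetoid S a b := Quotient.exact (Eq.trans ha (Eq.symm hb))
    obtain ⟨p⟩ := hab
    induction p with
    | nil => exact SimpleGraph.Reachable.refl _
    | @cons a c b hadj p ih =>
      have hac : s(a, c) ∈ S := ((SimpleGraph.fromEdgeSet_adj S).1 hadj).1
      have hc : Quotient.mk (componentSetoid S) c = C :=
        (Quotient.sound (componentSetoid_of_mem hac)).symm.trans ha
      exact SimpleGraph.Reachable.trans (SimpleGraph.Adj.reachable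
        (show (componentTree S hS C).coe.Adj ⟨a, ha⟩ ⟨c, hc⟩ from ⟨hac, ha⟩)) (ih hc hb)
  · refine SimpleGraph.IsAcyclic.comap (G' := SimpleGraph.fromEdgeSet S)
      ⟨Subtype.val, fun {a b} h => ?_⟩ Subtype.val_injective hac
    exact (SimpleGraph.fromEdgeSet_adj S).2 ⟨h.1, fun h' => (hS h.1).ne h'⟩

theorem mem_edgeSet_componentTree {S : Set (Sym2 (Fin N))} {hS : S ⊆ G.edgeSet}
    {C : Quotient (componentSetoid S)} {e : Sym2 (Fin N)}
    (he : e ∈ (componentTree S hS C).edgeSet) : e ∈ S := by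
  induction e with
  | _ a b => exact (SimpleGraph.Subgraph.mem_edgeSet.1 he).1

/-- The tree triple on the component `C` with the data `x`. -/
def componentTriple {S : Set (Sym2 (Fin N))} (hS : S ⊆ G.edgeSet) (hB : NoBrokenCircuit G o S)
    (C : Quotient (componentSetoid S)) (x : TripleData (classSize C)) : TreeTriple G o where
  tree := componentTree S hS C
  comp := x.1.blocks
  r := x.2.val + 1
  isNBCTree := ⟨componentTree_isTree hS (hB.isAcyclic hS) C, fun B h hBT =>
    hB B h fun _ he => mem_edgeSet_componentTree (hBT he)⟩
  comp_pos _ ha := x.1.blocks_pos ha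
  comp_sum := x.1.blocks_sum
  one_le_r := Nat.succ_pos _
  r_le := x.2.2

open Classical in
/-- The smallest elements of the equivalence classes. -/
def minimalReps (r : Setoid (Fin N)) : Finset (Fin N) :=
  Finset.univ.filter fun v => ∀ w, r v w → v ≤ w

theorem mem_minimalReps {r : Setoid (Fin N)} {v : Fin N} :
    v ∈ minimalReps r ↔ ∀ w, r v w → v ≤ w := by
  simp [minimalReps]

theorem exists_minimalRep {r : Setoid (Fin N)} (C : Quotient r) :
    ∃ v ∈ minimalReps r, Quotient.mk r v = C := by
  obtain ⟨v, hv⟩ := Quotient.exists_rep C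
  obtain ⟨w, hw, hmin⟩ := Set.exists_min_image {w | Quotient.mk r w = C} id (Set.toFinite _) ⟨v, hv⟩
  refine ⟨w, mem_minimalReps.2 fun u hu => hmin u ?_, hw⟩
  exact (Quotient.sound hu).symm.trans hw

theorem minimalReps_injOn {r : Setoid (Fin N)} {v w : Fin N} (hv : v ∈ minimalReps r)
    (hw : w ∈ minimalReps r) (h : Quotient.mk r v = Quotient.mk r w) : v = w := by
  have h := Quotient.exact h
  exact le_antisymm (mem_minimalReps.1 hv w h) (mem_minimalReps.1 hw v (r.symm h))

/-- Sums over equivalence classes as sums over sorted lists of representatives. -/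
theorem sum_map_sort_minimalReps {M : Type*} [AddCommMonoid M] (r : Setoid (Fin N))
    [Fintype (Quotient r)] (f : Quotient r → M) :
    (((minimalReps r).sort (· ≤ ·)).map fun v => f (Quotient.mk r v)).sum = ∑ C, f C := by
  rw [← Multiset.sum_coe, ← Multiset.map_coe, Finset.sort_eq]
  refine Finset.sum_bij (fun v _ => Quotient.mk r v) (fun _ _ => Finset.mem_univ _) ?_ ?_ ?_
  · exact fun v hv w hw h => minimalReps_injOn hv hw h
  · intro C _
    obtain ⟨v, hv, h⟩ := exists_minimalRep C
    exact ⟨v, hv, h⟩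
  · exact fun _ _ => rfl

theorem minVertex_componentTriple {S : Set (Sym2 (Fin N))} {hS : S ⊆ G.edgeSet}
    {hB : NoBrokenCircuit G o S} {v : Fin N} (hv : v ∈ minimalReps (componentSetoid S))
    (x : TripleData (classSize (Quotient.mk (componentSetoid S) v))) :
    (componentTriple hS hB _ x).minVertex = v.val := by
  refine le_antisymm (Nat.sInf_le ⟨v, rfl, rfl⟩) ?_
  refine le_csInf ⟨_, v, rfl, rfl⟩ ?_
  rintro _ ⟨w, hw, rfl⟩
  exact mem_minimalReps.1 hv w (Quotient.exact (Eq.symm hw))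

theorem ForestTriple.exists_mem (F : ForestTriple G o) (v : Fin N) :
    ∃ A ∈ F.triples, v ∈ A.tree.verts := by
  obtain ⟨i, hi, -⟩ := F.existsUnique_mem v
  exact ⟨_, List.get_mem _ _, hi⟩

theorem ForestTriple.eq_of_mem (F : ForestTriple G o) {v : Fin N} {A B : TreeTriple G o}
    (hA : A ∈ F.triples) (hB : B ∈ F.triples) (hvA : v ∈ A.tree.verts) (hvB : v ∈ B.tree.verts) :
    A = B := by
  obtain ⟨i, rfl⟩ := List.get_of_mem hA
  obtain ⟨j, rfl⟩ := List.get_of_mem hB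
  rw [(F.existsUnique_mem v).unique hvA hvB]

/-- The forest triple with given edges, compositions, and integers `r`. -/
def forestTripleOf {S : Set (Sym2 (Fin N))} (hS : S ⊆ G.edgeSet) (hB : NoBrokenCircuit G o S)
    (d : ∀ C : Quotient (componentSetoid S), TripleData (classSize C)) : ForestTriple G o where
  triples := ((minimalReps (componentSetoid S)).sort (· ≤ ·)).map fun v =>
    componentTriple hS hB (Quotient.mk _ v) (d _)
  existsUnique_mem := by
    intro v
    obtain ⟨w, hw, hwv⟩ := exists_minimalRep (Quotient.mk (componentSetoid S) v)
    obtain ⟨⟨i, hi⟩, hiw⟩ := List.get_of_mem ((Finset.mem_sort (· ≤ ·)).2 hw)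
    refine ⟨⟨i, by simpa using hi⟩, ?_, ?_⟩
    · simp only [List.get_eq_getElem, List.getElem_map] at hiw ⊢
      rw [hiw]
      exact hwv.symm
    · rintro ⟨j, hj⟩ hjv
      have hj' : j < ((minimalReps (componentSetoid S)).sort (· ≤ ·)).length := by simpa using hj
      simp only [List.get_eq_getElem, List.getElem_map] at hiw hjv
      have hjv : Quotient.mk (componentSetoid S) v = Quotient.mk _ _ := hjv
      have := minimalReps_injOn hw ((Finset.mem_sort (· ≤ ·)).1 (List.getElem_mem hj'))
        (hwv.trans hjv)
      rw [← hiw] at this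
      exact Fin.ext (((Finset.sort_nodup _ _).getElem_inj_iff).1 this).symm
  sorted := by
    rw [List.pairwise_map]
    refine List.Pairwise.imp_of_mem ?_
      (Finset.sortedLT_sort (minimalReps (componentSetoid S))).pairwise
    intro v w hv hw hlt
    rw [minVertex_componentTriple ((Finset.mem_sort (· ≤ ·)).1 hv),
      minVertex_componentTriple ((Finset.mem_sort (· ≤ ·)).1 hw)]
    exact hlt

theorem mem_forestTripleOf {S : Set (Sym2 (Fin N))} {hS : S ⊆ G.edgeSet}
    {hB : NoBrokenCircuit G o S} {d : ∀ C : Quotient (componentSetoid S), TripleData (classSize C)}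
    {A : TreeTriple G o} :
    A ∈ (forestTripleOf hS hB d).triples ↔ ∃ C, A = componentTriple hS hB C (d C) := by
  constructor
  · intro h
    obtain ⟨v, -, rfl⟩ := List.mem_map.1 h
    exact ⟨_, rfl⟩
  · rintro ⟨C, rfl⟩
    obtain ⟨v, hv, rfl⟩ := exists_minimalRep C
    exact List.mem_map.2 ⟨v, (Finset.mem_sort _).2 hv, rfl⟩

/-- The edges of a forest triple. -/
def ForestTriple.edgeSet (F : ForestTriple G o) : Set (Sym2 (Fin N)) :=
  {e | ∃ A ∈ F.triples, e ∈ A.tree.edgeSet}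

theorem edgeSet_forestTripleOf {S : Set (Sym2 (Fin N))} {hS : S ⊆ G.edgeSet}
    {hB : NoBrokenCircuit G o S}
    {d : ∀ C : Quotient (componentSetoid S), TripleData (classSize C)} :
    (forestTripleOf hS hB d).edgeSet = S := by
  ext e
  constructor
  · rintro ⟨A, hA, he⟩
    obtain ⟨C, rfl⟩ := mem_forestTripleOf.1 hA
    exact mem_edgeSet_componentTree (hS := hS) (C := C) he
  · intro he
    induction e with
    | _ a b => exact ⟨_, mem_forestTripleOf.2 ⟨Quotient.mk _ a, rfl⟩, ⟨he, rfl⟩⟩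

theorem TripleData.ext {m : ℕ} {x y : TripleData m} (h₁ : x.1.blocks = y.1.blocks)
    (h₂ : x.2.val = y.2.val) : x = y := by
  obtain ⟨α, r⟩ := x
  obtain ⟨β, s⟩ := y
  obtain rfl : α = β := Composition.ext h₁
  obtain rfl : r = s := Fin.ext h₂
  rfl

theorem forestTripleOf_injective {S : Set (Sym2 (Fin N))} {hS : S ⊆ G.edgeSet}
    {hB : NoBrokenCircuit G o S} :
    Function.Injective (forestTripleOf (o := o) hS hB) := by
  intro d d' h
  funext C
  have hmem : componentTriple hS hB C (d C) ∈ (forestTripleOf hS hB d').triples :=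
    h ▸ mem_forestTripleOf.2 ⟨C, rfl⟩
  obtain ⟨C', hC'⟩ := mem_forestTripleOf.1 hmem
  have hv : {v | Quotient.mk _ v = C} = {v | Quotient.mk _ v = C'} :=
    congrArg (fun A => A.tree.verts) hC'
  obtain ⟨v, rfl⟩ := Quotient.exists_rep C
  obtain rfl : Quotient.mk _ v = C' := (Set.ext_iff.1 hv v).1 rfl
  exact TripleData.ext (congrArg TreeTriple.comp hC')
    (Nat.succ_injective (congrArg TreeTriple.r hC'))

theorem ForestTriple.edgeSet_subset (F : ForestTriple G o) : F.edgeSet ⊆ G.edgeSet := by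
  rintro e ⟨A, -, he⟩
  exact A.tree.edgeSet_subset he

theorem ForestTriple.adj_of_mem_edgeSet (F : ForestTriple G o) {a b : Fin N} {A : TreeTriple G o}
    (hA : A ∈ F.triples) (ha : a ∈ A.tree.verts) (h : s(a, b) ∈ F.edgeSet) : A.tree.Adj a b := by
  obtain ⟨B, hB, hab⟩ := h
  rw [F.eq_of_mem hA hB ha (SimpleGraph.Subgraph.mem_edgeSet.1 hab).fst_mem]
  exact hab

/-- The trees are connected and pairwise disjoint, so they are the components of the union of their
edges. -/
theorem ForestTriple.componentSetoid_iff (F : ForestTriple G o) {a b : Fin N} {A : TreeTriple G o}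
    (hA : A ∈ F.triples) (ha : a ∈ A.tree.verts) :
    componentSetoid F.edgeSet a b ↔ b ∈ A.tree.verts := by
  constructor
  · rintro ⟨p⟩
    induction p with
    | nil => exact ha
    | cons hadj _ ih =>
      have := ((SimpleGraph.fromEdgeSet_adj _).1 hadj).1
      exact ih (F.adj_of_mem_edgeSet hA ha this).snd_mem
  · intro hb
    obtain ⟨p⟩ := A.isNBCTree.1.connected.preconnected ⟨a, ha⟩ ⟨b, hb⟩
    let f : A.tree.coe →g SimpleGraph.fromEdgeSet F.edgeSet := ⟨Subtype.val, fun {x y} hxy =>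
      (SimpleGraph.fromEdgeSet_adj _).2 ⟨⟨A, hA, hxy⟩, fun h => (A.tree.adj_sub hxy).ne h⟩⟩
    exact ⟨p.map f⟩

/-- The definition excludes broken circuits only tree by tree. This suffices: smaller edges joining
the ends of an active edge form a path inside one tree, so the edge would be active for that tree.
-/
theorem ForestTriple.noBrokenCircuit (F : ForestTriple G o) :
    NoBrokenCircuit G o F.edgeSet := by
  rw [noBrokenCircuit_iff, Set.eq_empty_iff_forall_notMem]
  rintro e ⟨u, v, huv, h⟩
  obtain ⟨A, hA, hu⟩ := F.exists_mem u
  have hAB : NoBrokenCircuit G o A.tree.edgeSet := A.isNBCTree.2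
  rw [noBrokenCircuit_iff, Set.eq_empty_iff_forall_notMem] at hAB
  refine hAB e ⟨u, v, huv, ?_⟩
  clear huv hAB
  obtain ⟨p⟩ := h
  induction p with
  | nil => exact SimpleGraph.Reachable.refl _
  | @cons a b c hadj _ ih =>
    have h := ((SimpleGraph.fromEdgeSet_adj _).1 hadj).1
    have hab := F.adj_of_mem_edgeSet hA hu h.1
    exact SimpleGraph.Reachable.trans (SimpleGraph.Adj.reachable
      ((SimpleGraph.fromEdgeSet_adj _).2 ⟨⟨hab, h.2⟩, (A.tree.adj_sub hab).ne⟩)) (ih hab.snd_mem)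

theorem ForestTriple.exists_eq_forestTripleOf (F : ForestTriple G o) :
    ∃ d, forestTripleOf F.edgeSet_subset F.noBrokenCircuit d = F := by
  have hex : ∀ C : Quotient (componentSetoid F.edgeSet), ∃ x : TripleData (classSize C),
      componentTriple F.edgeSet_subset F.noBrokenCircuit C x ∈ F.triples := by
    intro C
    obtain ⟨v, rfl⟩ := Quotient.exists_rep C
    obtain ⟨A, hA, hv⟩ := F.exists_mem v
    have hverts : {w | Quotient.mk (componentSetoid F.edgeSet) w = Quotient.mk _ v} =
        A.tree.verts := by
      ext w
      rw [← F.componentSetoid_iff hA hv]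
      exact ⟨fun h => Quotient.exact (Eq.symm h), fun h => (Quotient.sound h).symm⟩
    have h₁ := A.one_le_r
    have h₂ := A.r_le
    refine ⟨⟨⟨A.comp, fun {a} ha => A.comp_pos a ha, A.comp_sum.trans (by rw [classSize, hverts])⟩,
      ⟨A.r - 1, by simp only; omega⟩⟩, ?_⟩
    convert hA using 1
    refine TreeTriple.ext (SimpleGraph.Subgraph.ext hverts ?_) rfl
      (by simp [componentTriple]; omega)
    funext a b
    refine propext ⟨?_, ?_⟩
    · rintro ⟨hab, ha⟩
      exact F.adj_of_mem_edgeSet hA ((Set.ext_iff.1 hverts a).1 ha) hab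
    · intro hab
      exact ⟨⟨A, hA, hab⟩, (Set.ext_iff.1 hverts a).2 hab.fst_mem⟩
  choose d hd using hex
  refine ⟨d, ForestTriple.ext ?_⟩
  have hne : ∀ {A B : TreeTriple G o}, A.minVertex < B.minVertex → A ≠ B := by
    rintro A _ h rfl
    exact lt_irrefl _ h
  -- Both lists are strictly sorted by smallest vertex, so it is enough that they have the same
  -- members.
  refine List.Perm.eq_of_pairwise (fun A B _ _ h h' => absurd (h.trans h') (lt_irrefl _))
    (forestTripleOf _ _ d).sorted F.sorted ?_
  refine (List.perm_ext_iff_of_nodup ?_ ?_).2 fun A => ?_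
  · exact (forestTripleOf _ _ d).sorted.imp hne
  · exact F.sorted.imp hne
  · rw [mem_forestTripleOf]
    constructor
    · rintro ⟨C, rfl⟩
      exact hd C
    · intro hA
      have hne : A.tree.verts.Nonempty := by
        obtain ⟨v⟩ := A.isNBCTree.1.connected.nonempty
        exact ⟨v.1, v.2⟩
      obtain ⟨v, hv⟩ := hne
      exact ⟨Quotient.mk _ v, F.eq_of_mem hA (hd _) hv rfl⟩

/-- Forest triples correspond to edge sets without broken circuits and decorations of the
components. -/
def forestTripleEquiv (G : SimpleGraph (Fin N)) (o : LinearOrder G.edgeSet) :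
    (Σ S : noBrokenCircuitSets G o, ∀ C : Quotient (componentSetoid
      ((S : Finset (Sym2 (Fin N))) : Set (Sym2 (Fin N)))), TripleData (classSize C)) ≃
      ForestTriple G o :=
  Equiv.ofBijective (fun x => forestTripleOf
      (coe_subset_edgeSet (mem_noBrokenCircuitSets.1 x.1.2).1)
      (mem_noBrokenCircuitSets.1 x.1.2).2 x.2) <| by
    constructor
    · rintro ⟨S, d⟩ ⟨S', d'⟩ h
      have hS : S = S' := by
        have := congrArg ForestTriple.edgeSet h
        simp only [edgeSet_forestTripleOf] at this
        exact Subtype.ext (Finset.coe_injective this)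
      subst hS
      exact congrArg (Sigma.mk S) (forestTripleOf_injective h)
    · intro F
      have hfin : (F.edgeSet.toFinite.toFinset : Set (Sym2 (Fin N))) = F.edgeSet := by simp
      obtain ⟨d, hd⟩ := F.exists_eq_forestTripleOf
      have hmem : F.edgeSet.toFinite.toFinset ∈ noBrokenCircuitSets G o := by
        rw [mem_noBrokenCircuitSets, hfin]
        refine ⟨fun e he => mem_edges.2 (F.edgeSet_subset ?_), F.noBrokenCircuit⟩
        simpa using he
      -- The type of decorations depends on the edge set, so the equality of edge sets is
      -- substituted in a general statement.
      have key : ∀ (T : Set (Sym2 (Fin N))) (hT : T = F.edgeSet) (h₁ : T ⊆ G.edgeSet)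
          (h₂ : NoBrokenCircuit G o T), ∃ d, forestTripleOf h₁ h₂ d = F := by
        rintro T rfl h₁ h₂
        exact ⟨d, hd⟩
      obtain ⟨d', hd'⟩ := key _ hfin (coe_subset_edgeSet (mem_noBrokenCircuitSets.1 hmem).1)
        (mem_noBrokenCircuitSets.1 hmem).2
      exact ⟨⟨⟨_, hmem⟩, d'⟩, hd'⟩

/-! ### Counting the edges and components of a forest -/

instance {V : Type*} [Finite V] (r : Setoid V) : Fintype (Quotient r) := Fintype.ofFinite _

theorem sum_classSize (r : Setoid (Fin N)) : ∑ C : Quotient r, classSize C = N := by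
  classical
  have := Finset.card_eq_sum_card_fiberwise (s := (Finset.univ : Finset (Fin N)))
    (t := (Finset.univ : Finset (Quotient r))) (f := Quotient.mk r) (fun _ _ => Finset.mem_univ _)
  rw [Finset.card_univ, Fintype.card_fin] at this
  conv_rhs => rw [this]
  refine Finset.sum_congr rfl fun C _ => ?_
  rw [classSize, Set.ncard_eq_toFinset_card']
  congr 1
  ext v
  simp

theorem classSize_pos {V : Type*} [Finite V] {r : Setoid V} (C : Quotient r) : 0 < classSize C := by
  obtain ⟨v, hv⟩ := Quotient.exists_rep C
  exact (Set.ncard_pos (Set.toFinite _)).2 ⟨v, hv⟩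

/-- The number of edges of a forest. -/
theorem card_add_card_quotient {S : Finset (Sym2 (Fin N))} (hS : S ⊆ edges G)
    (hac : (SimpleGraph.fromEdgeSet (S : Set (Sym2 (Fin N)))).IsAcyclic) :
    S.card + Fintype.card (Quotient (componentSetoid (S : Set (Sym2 (Fin N))))) = N := by
  classical
  set r := componentSetoid (S : Set (Sym2 (Fin N))) with hr
  -- Each edge is counted at the class of a chosen end; a tree component has one edge fewer than it
  -- has vertices.
  have hfib := Finset.card_eq_sum_card_fiberwise (s := S)
    (t := (Finset.univ : Finset (Quotient r))) (f := fun e => Quotient.mk r (Quot.out e).1)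
    (fun _ _ => Finset.mem_univ _)
  rw [hfib, ← Finset.card_univ, Finset.card_eq_sum_ones, ← Finset.sum_add_distrib]
  conv_rhs => rw [← sum_classSize r]
  refine Finset.sum_congr rfl fun C _ => ?_
  set T := componentTree (S : Set (Sym2 (Fin N))) (coe_subset_edgeSet hS) C with hT
  have hcard := (SimpleGraph.isTree_iff_connected_and_card.1
    (componentTree_isTree (coe_subset_edgeSet hS) hac C)).2
  have hcls : ∀ a b, s(a, b) ∈ S →
      (Quotient.mk r (Quot.out s(a, b)).1 = C ↔ Quotient.mk r a = C) := by
    intro a b hab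
    have hrel : Quotient.mk r a = Quotient.mk r b := Quotient.sound (componentSetoid_of_mem hab)
    have : s((Quot.out s(a, b)).1, (Quot.out s(a, b)).2) = s(a, b) := Quot.out_eq s(a, b)
    rcases Sym2.eq_iff.1 this with ⟨h, -⟩ | ⟨h, -⟩
    · rw [h]
    · rw [h, hrel]
  rw [show classSize C = Nat.card T.verts from rfl, ← hcard, Nat.add_right_cancel_iff,
    ← Nat.card_eq_finsetCard]
  symm
  refine Nat.card_eq_of_bijective (fun e => ⟨e.1.map Subtype.val, ?_⟩) ⟨?_, ?_⟩
  · obtain ⟨e, he⟩ := e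
    induction e with
    | _ a b =>
      have he : s(a.1, b.1) ∈ S ∧ Quotient.mk r a.1 = C := he
      exact Finset.mem_filter.2 ⟨he.1, (hcls _ _ he.1).2 he.2⟩
  · intro e e' h
    exact Subtype.ext (Sym2.map.injective Subtype.val_injective (Subtype.ext_iff.1 h))
  · rintro ⟨e, he⟩
    induction e with
    | _ a b =>
      obtain ⟨h₁, h₂⟩ := Finset.mem_filter.1 he
      have ha := (hcls a b h₁).1 h₂
      have hb : Quotient.mk r b = C := (Quotient.sound (componentSetoid_of_mem h₁)).symm.trans ha
      exact ⟨⟨s(⟨a, ha⟩, ⟨b, hb⟩), ⟨h₁, ha⟩⟩, rfl⟩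

/-- A sum over the edge sets without broken circuits, as an alternating sum over all edge sets. -/
theorem sum_noBrokenCircuitSets {R : Type*} [CommRing R] (o : LinearOrder G.edgeSet)
    (φ : Setoid (Fin N) → R) :
    ∑ S ∈ noBrokenCircuitSets G o, φ (componentSetoid (S : Set (Sym2 (Fin N)))) =
      ∑ S ∈ (edges G).powerset, (-1) ^ S.card *
        ((-1) ^ (N + Fintype.card (Quotient (componentSetoid (S : Set (Sym2 (Fin N)))))) *
          φ (componentSetoid (S : Set (Sym2 (Fin N))))) := by
  -- Whitney's theorem is applied to $\varphi$ with an extra sign. On edge sets without broken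
  -- circuits that sign equals $(-1)^{|S|}$, because the number of edges plus the number of
  -- components is $N$.
  rw [sum_powerset_eq_sum_noBrokenCircuit o
    (fun r => (-1) ^ (N + Fintype.card (Quotient r)) * φ r)]
  refine Finset.sum_congr rfl fun S hS => ?_
  obtain ⟨hS, hB⟩ := mem_noBrokenCircuitSets.1 hS
  have := card_add_card_quotient hS (hB.isAcyclic (coe_subset_edgeSet hS))
  rw [← mul_assoc, ← pow_add, ← add_assoc, add_right_comm, this, ← two_mul,
    Even.neg_one_pow (even_two_mul _), one_mul]

/-! ### The weight of a forest triple -/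

theorem elementaryProd_sum {I : Type*} (s : Finset I) (f : I → Multiset ℕ) :
    elementaryProd (∑ i ∈ s, f i) = ∏ i ∈ s, elementaryProd (f i) := by
  classical
  induction s using Finset.induction_on with
  | empty => simp [elementaryProd]
  | insert i s hi ih => rw [Finset.sum_insert hi, Finset.prod_insert hi, elementaryProd_add, ih]

theorem coe_flatMap {α β : Type*} (L : List α) (f : α → List β) :
    ((L.flatMap f : List β) : Multiset β) = (L.map fun a => (f a : Multiset β)).sum := by
  induction L with
  | nil => rfl
  | cons a L ih => rw [List.flatMap_cons, ← Multiset.coe_add, ih, List.map_cons, List.sum_cons]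

/-- The tree through vertex `0` has the least possible smallest vertex, hence heads the sorted list.
-/
theorem ForestTriple.firstPart_eq (F : ForestTriple G o) {A : TreeTriple G o} (hA : A ∈ F.triples)
    {v : Fin N} (hv : v ∈ A.tree.verts) (hv0 : v.val = 0) : F.firstPart = A.comp.headD 0 := by
  have hmin : A.minVertex = 0 := Nat.le_zero.1 (Nat.sInf_le ⟨v, hv, hv0⟩)
  have hs := F.sorted
  unfold ForestTriple.firstPart
  cases hL : F.triples with
  | nil => simp [hL] at hA
  | cons B L =>
    rw [hL] at hA hs
    rcases List.mem_cons.1 hA with rfl | hA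
    · rfl
    · have := (List.pairwise_cons.1 hs).1 A hA
      omega

open Classical in
theorem sign_smul_elementaryProd_reducedType {S : Set (Sym2 (Fin N))} (hS : S ⊆ G.edgeSet)
    (hB : NoBrokenCircuit G o S)
    (d : ∀ C : Quotient (componentSetoid S), TripleData (classSize C)) {x : Fin N}
    (hx : x.val = 0) :
    (forestTripleOf hS hB d).sign • elementaryProd (forestTripleOf hS hB d).reducedType =
      ∏ C, ((-1) ^ ((d C).1.blocks.length - 1) * elementaryProd
        ((if Quotient.mk _ x = C then (d C).1.blocks.tail else (d C).1.blocks : List ℕ) :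
          Multiset ℕ)) := by
  have htype : (forestTripleOf hS hB d).type = ∑ C, ((d C).1.blocks : Multiset ℕ) := by
    rw [ForestTriple.type, coe_flatMap, forestTripleOf, List.map_map]
    exact sum_map_sort_minimalReps (componentSetoid S) (fun C => ((d C).1.blocks : Multiset ℕ))
  have hsign : (forestTripleOf hS hB d).sign = ∏ C, (-1) ^ ((d C).1.blocks.length - 1) := by
    rw [ForestTriple.sign, Finset.prod_pow_eq_pow_sum, forestTripleOf, List.map_map]
    congr 1
    exact sum_map_sort_minimalReps (componentSetoid S) (fun C => (d C).1.blocks.length - 1)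
  have hfirst : (forestTripleOf hS hB d).firstPart =
      (d (Quotient.mk _ x)).1.blocks.headD 0 :=
    ForestTriple.firstPart_eq _ (mem_forestTripleOf.2 ⟨Quotient.mk _ x, rfl⟩)
      (show x ∈ {v | Quotient.mk _ v = Quotient.mk _ x} from rfl) hx
  have hred : (forestTripleOf hS hB d).reducedType = ∑ C,
      ((if Quotient.mk _ x = C then (d C).1.blocks.tail else (d C).1.blocks : List ℕ) :
          Multiset ℕ) := by
    -- The composition is nonempty, because the shifted `r` is an element of `Fin` of its first
    -- part.
    have hcons : (d (Quotient.mk _ x)).1.blocks = (d (Quotient.mk _ x)).1.blocks.headD 0 ::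
        (d (Quotient.mk _ x)).1.blocks.tail := by
      have h := (d (Quotient.mk _ x)).2.pos
      cases hb : (d (Quotient.mk _ x)).1.blocks with
      | nil => rw [hb] at h; simp at h
      | cons a l => rfl
    rw [ForestTriple.reducedType, hfirst, htype,
      ← Finset.add_sum_erase _ _ (Finset.mem_univ (Quotient.mk (componentSetoid S) x)),
      ← Finset.add_sum_erase _ _ (Finset.mem_univ (Quotient.mk (componentSetoid S) x)), if_pos rfl]
    conv_lhs =>
      enter [1, 1]
      rw [hcons]
    rw [← Multiset.cons_coe, Multiset.cons_add, Multiset.erase_cons_head]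
    congr 1
    refine Finset.sum_congr rfl fun C hC => ?_
    rw [if_neg (Finset.ne_of_mem_erase hC).symm]
  rw [hred, elementaryProd_sum, hsign, Finset.prod_mul_distrib, zsmul_eq_mul]
  congr 1
  push_cast
  rfl

end Decorations

open Classical in
/-- The entries of the forest triple matrix as sums over edge sets without broken circuits. -/
theorem forestTripleMatrix_eq_sum_noBrokenCircuitSets {n : ℕ} (G : SimpleGraph (Fin n))
    (o : ∀ j : ℕ+, LinearOrder (glue G (SimpleGraph.pathGraph (j : ℕ))).edgeSet) (i j : ℕ+)
    (x z : Fin (n + j - 1)) (hx : x.val = 0) (hz : z.val = n - 1) :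
    forestTripleMatrix G o i j = ∑ S ∈ noBrokenCircuitSets _ (o j),
      (fun r : Setoid (Fin (n + j - 1)) => if ∀ v : Fin (n + j - 1), n - 1 ≤ v.val → r z v then
        ∏ C : Quotient r, treeWeight i j (Quotient.mk r x = C) (Quotient.mk r z = C) (classSize C)
        else 0) (componentSetoid (S : Set (Sym2 (Fin (n + j - 1))))) := by
  set H := glue G (SimpleGraph.pathGraph (j : ℕ)) with hH
  have hterm : ∀ (S : Set (Sym2 (Fin (n + j - 1)))) (hS : S ⊆ H.edgeSet)
      (hB : NoBrokenCircuit H (o j) S)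
      (d : ∀ C : Quotient (componentSetoid S), TripleData (classSize C)),
      (restrictedForestTriples G i j (o j)).indicator
        (fun F => F.sign • elementaryProd F.reducedType) (forestTripleOf hS hB d) =
      if ∀ v : Fin (n + j - 1), n - 1 ≤ v.val → componentSetoid S z v then
        ∏ C, tripleWeight i j (Quotient.mk (componentSetoid S) x = C)
          (Quotient.mk (componentSetoid S) z = C) (d C) else 0 := by
    intro S hS hB d
    have hiff : forestTripleOf hS hB d ∈ restrictedForestTriples G i j (o j) ↔
        (∀ v : Fin (n + j - 1), n - 1 ≤ v.val → componentSetoid S z v) ∧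
        ∀ C ∈ Finset.univ, (Quotient.mk (componentSetoid S) x = C →
          (d C).1.blocks.headD 0 = i ∧ (d C).2.val = 0) ∧
          (Quotient.mk (componentSetoid S) z = C → j ≤ (d C).1.blocks.getLastD 0) := by
      constructor
      · rintro ⟨⟨A, hA, ⟨v, hv, hv0⟩, h₁, h₂⟩, A', hA', ⟨v', hv', hvz⟩, h₃, h₄⟩
        obtain rfl : v = x := Fin.ext (hv0.trans hx.symm)
        obtain rfl : v' = z := Fin.ext (hvz.trans hz.symm)
        obtain ⟨C, rfl⟩ := mem_forestTripleOf.1 hA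
        obtain ⟨C', rfl⟩ := mem_forestTripleOf.1 hA'
        obtain rfl : Quotient.mk _ v = C := hv
        obtain rfl : Quotient.mk _ v' = C' := hv'
        refine ⟨fun w hw => Quotient.exact (Eq.symm (h₃ w hw)), ?_⟩
        rintro C -
        constructor
        · rintro rfl
          exact ⟨h₁, Nat.succ_injective h₂⟩
        · rintro rfl
          exact h₄
      · rintro ⟨h₁, h₂⟩
        have hx' := (h₂ _ (Finset.mem_univ _)).1 rfl
        refine ⟨⟨_, mem_forestTripleOf.2 ⟨Quotient.mk _ x, rfl⟩, ⟨x, rfl, hx⟩, hx'.1,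
          congrArg Nat.succ hx'.2⟩, _, mem_forestTripleOf.2 ⟨Quotient.mk _ z, rfl⟩, ⟨z, rfl, hz⟩,
          fun v hv => (Quotient.sound (h₁ v hv)).symm, (h₂ _ (Finset.mem_univ _)).2 rfl⟩
    rw [Set.indicator_apply, sign_smul_elementaryProd_reducedType hS hB d hx]
    by_cases h : forestTripleOf hS hB d ∈ restrictedForestTriples G i j (o j)
    · rw [if_pos h, if_pos (hiff.1 h).1]
      refine Finset.prod_congr rfl fun C hC => ?_
      rw [tripleWeight, if_pos ((hiff.1 h).2 C hC)]
      congr!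
    · rw [if_neg h]
      split_ifs with h₁
      · obtain ⟨C, hC⟩ : ∃ C, ¬ ((Quotient.mk (componentSetoid S) x = C →
            (d C).1.blocks.headD 0 = i ∧ (d C).2.val = 0) ∧
            (Quotient.mk (componentSetoid S) z = C → j ≤ (d C).1.blocks.getLastD 0)) := by
          by_contra hcon
          exact h (hiff.2 ⟨h₁, fun C _ => not_not.1 fun h' => hcon ⟨C, h'⟩⟩)
        exact (Finset.prod_eq_zero (Finset.mem_univ C) (if_neg hC)).symm
      · rfl
  rw [forestTripleMatrix, finsum_mem_def, ← finsum_comp_equiv (forestTripleEquiv H (o j)),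
    finsum_eq_sum_of_fintype, Fintype.sum_sigma,
    ← Finset.sum_coe_sort (noBrokenCircuitSets H (o j))]
  refine Finset.sum_congr rfl fun S _ => ?_
  refine (Finset.sum_congr rfl fun d _ => hterm _
    (coe_subset_edgeSet (mem_noBrokenCircuitSets.1 S.2).1)
    (mem_noBrokenCircuitSets.1 S.2).2 d).trans ?_
  beta_reduce
  split_ifs with h
  · simp only [treeWeight]
    -- The components are decorated independently, so the sum over all decorations is a product of
    -- sums.
    rw [Finset.prod_univ_sum, Fintype.piFinset_univ]
  · exact Finset.sum_const_zero

/-! ### Edge sets of a graph with a path attached -/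

section Lift

variable {n j : ℕ}

/-- The inclusion of the vertices of `G` into those of `G + P_j`. -/
def inclusion (hj : 0 < j) (u : Fin n) : Fin (n + j - 1) := ⟨u.val, by omega⟩

/-- The map that contracts the path of `G + P_j` to the last vertex of `G`. -/
def contraction (hn : 0 < n) (v : Fin (n + j - 1)) : Fin n := ⟨min v.val (n - 1), by omega⟩

theorem contraction_inclusion (hn : 0 < n) (hj : 0 < j) (u : Fin n) :
    contraction hn (inclusion hj u) = u := by
  ext
  simp only [contraction, inclusion]
  omega

theorem inclusion_injective (hj : 0 < j) : Function.Injective (inclusion (n := n) hj) := by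
  intro u v h
  have h := congrArg Fin.val h
  exact Fin.ext h

/-- The edges of the path in `G + P_j`. -/
def pathEdge (hn : 0 < n) (u : Fin (j - 1)) : Sym2 (Fin (n + j - 1)) :=
  s(⟨n - 1 + u.val, by omega⟩, ⟨n - 1 + u.val + 1, by omega⟩)

theorem pathEdge_injective (hn : 0 < n) : Function.Injective (pathEdge (j := j) hn) := by
  intro u v h
  rcases Sym2.eq_iff.1 h with ⟨h, -⟩ | ⟨h, h'⟩
  · exact Fin.ext (by have := Fin.ext_iff.1 h; simp at this; omega)
  · have := Fin.ext_iff.1 h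
    have := Fin.ext_iff.1 h'
    simp at *
    omega

open Classical in
/-- The edge set of `G + P_j` that consists of an edge set of `G` and the edges of the path. -/
def addPath (hn : 0 < n) (hj : 0 < j) (S : Finset (Sym2 (Fin n))) :
    Finset (Sym2 (Fin (n + j - 1))) :=
  S.image (Sym2.map (inclusion hj)) ∪ Finset.univ.image (pathEdge hn)

theorem mem_addPath (hn : 0 < n) (hj : 0 < j) {S : Finset (Sym2 (Fin n))}
    {e : Sym2 (Fin (n + j - 1))} :
    e ∈ addPath hn hj S ↔ (∃ f ∈ S, f.map (inclusion hj) = e) ∨ ∃ u, pathEdge hn u = e := by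
  simp [addPath]

theorem map_inclusion_ne_pathEdge (hn : 0 < n) (hj : 0 < j) (f : Sym2 (Fin n)) (u : Fin (j - 1)) :
    f.map (inclusion hj) ≠ pathEdge hn u := by
  induction f with
  | _ a b =>
    intro h
    have ha := a.2
    have hb := b.2
    rcases Sym2.eq_iff.1 (show s(inclusion hj a, inclusion hj b) = s(_, _) from h) with
      ⟨-, h⟩ | ⟨h, -⟩
    · have := Fin.ext_iff.1 h
      simp only [inclusion] at this
      omega
    · have := Fin.ext_iff.1 h
      simp only [inclusion] at this
      omega

theorem map_inclusion_mem_addPath (hn : 0 < n) (hj : 0 < j) {S : Finset (Sym2 (Fin n))}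
    {f : Sym2 (Fin n)} :
    f.map (inclusion hj) ∈ addPath hn hj S ↔ f ∈ S := by
  rw [mem_addPath]
  constructor
  · rintro (⟨g, hg, h⟩ | ⟨u, h⟩)
    · rwa [← Sym2.map.injective (inclusion_injective hj) h]
    · exact absurd h.symm (map_inclusion_ne_pathEdge hn hj f u)
  · exact fun h => Or.inl ⟨f, h, rfl⟩

theorem addPath_injective (hn : 0 < n) (hj : 0 < j) :
    Function.Injective (addPath (n := n) hn hj) := by
  intro S T h
  ext f
  rw [← map_inclusion_mem_addPath hn hj, h, map_inclusion_mem_addPath]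

theorem card_addPath (hn : 0 < n) (hj : 0 < j) (S : Finset (Sym2 (Fin n))) :
    (addPath hn hj S).card = S.card + (j - 1) := by
  classical
  rw [addPath, Finset.card_union_of_disjoint, Finset.card_image_of_injective _
    (Sym2.map.injective (inclusion_injective hj)),
    Finset.card_image_of_injective _ (pathEdge_injective hn), Finset.card_univ, Fintype.card_fin]
  rw [Finset.disjoint_left]
  intro e he he'
  obtain ⟨f, -, rfl⟩ := Finset.mem_image.1 he
  obtain ⟨u, -, hu⟩ := Finset.mem_image.1 he'
  exact map_inclusion_ne_pathEdge hn hj f u hu.symm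

theorem mem_edgeSet_glue (hn : 0 < n) (hj : 0 < j) {G : SimpleGraph (Fin n)}
    {e : Sym2 (Fin (n + j - 1))} :
    e ∈ (glue G (SimpleGraph.pathGraph j)).edgeSet ↔
      (∃ f ∈ G.edgeSet, f.map (inclusion hj) = e) ∨ ∃ u, pathEdge hn u = e := by
  constructor
  · induction e with
    | _ a b =>
      rintro (⟨u, v, huv, ha, hb⟩ | ⟨u, v, huv, ha, hb⟩)
      · refine Or.inl ⟨s(u, v), huv, ?_⟩
        rw [Sym2.map_mk, show inclusion hj u = a from Fin.ext ha.symm,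
          show inclusion hj v = b from Fin.ext hb.symm]
      · refine Or.inr ?_
        simp only at ha hb
        have hu := u.2
        have hv := v.2
        rcases SimpleGraph.pathGraph_adj.1 huv with h | h
        · refine ⟨⟨u.val, by omega⟩, ?_⟩
          rw [pathEdge, Sym2.eq_iff]
          left
          constructor <;> ext <;> simp only <;> omega
        · refine ⟨⟨v.val, by omega⟩, ?_⟩
          rw [pathEdge, Sym2.eq_iff]
          right
          constructor <;> ext <;> simp only <;> omega
  · rintro (⟨f, hf, rfl⟩ | ⟨u, rfl⟩)
    · induction f with
      | _ a b => exact Or.inl ⟨a, b, hf, rfl, rfl⟩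
    · have hu := u.2
      refine Or.inr ⟨⟨u.val, by omega⟩, ⟨u.val + 1, by omega⟩, ?_, ?_, ?_⟩
      · rw [SimpleGraph.pathGraph_adj]
        left
        rfl
      · simp only
        omega
      · simp only
        omega

/-- The added path joins all vertices from $n$ on, so contracting it to $n$ does not change
connectivity. -/
theorem componentSetoid_addPath (hn : 0 < n) (hj : 0 < j) (S : Finset (Sym2 (Fin n))) :
    componentSetoid (addPath hn hj S : Set (Sym2 (Fin (n + j - 1)))) =
      (componentSetoid (S : Set (Sym2 (Fin n)))).comap (contraction hn) := by
  set r := componentSetoid (addPath hn hj S : Set (Sym2 (Fin (n + j - 1)))) with hr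
  apply le_antisymm
  · rw [hr, componentSetoid_le_iff]
    intro a b hab
    rw [Setoid.comap_rel]
    rcases (mem_addPath hn hj).1 (Finset.mem_coe.1 hab) with ⟨f, hf, h⟩ | ⟨u, h⟩
    · induction f with
      | _ c d =>
        have hcd := componentSetoid_of_mem (Finset.mem_coe.2 hf)
        rcases Sym2.eq_iff.1 (show s(inclusion hj c, inclusion hj d) = s(a, b) from h) with
          ⟨rfl, rfl⟩ | ⟨rfl, rfl⟩
        · simpa only [contraction_inclusion] using hcd
        · simpa only [contraction_inclusion] using Setoid.symm' _ hcd
    · have : contraction hn a = contraction hn b := by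
        rcases Sym2.eq_iff.1 h with ⟨rfl, rfl⟩ | ⟨rfl, rfl⟩ <;> ext <;>
          simp only [contraction] <;> omega
      rw [this]
  · have hincl : componentSetoid (S : Set (Sym2 (Fin n))) ≤ r.comap (inclusion hj) := by
      rw [componentSetoid_le_iff]
      intro a b hab
      exact componentSetoid_of_mem
        (Finset.mem_coe.2 ((map_inclusion_mem_addPath hn hj (f := s(a, b))).2 hab))
    have hpath : ∀ (m : ℕ) (hm : n - 1 + m < n + j - 1),
        r (inclusion hj ⟨n - 1, by omega⟩) ⟨n - 1 + m, hm⟩ := by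
      intro m
      induction m with
      | zero => exact fun _ => Setoid.refl' _ _
      | succ m ih =>
        intro hm
        refine Setoid.trans' _ (ih (by omega)) (componentSetoid_of_mem (Finset.mem_coe.2 ?_))
        exact (mem_addPath hn hj).2 (Or.inr ⟨⟨m, by omega⟩, rfl⟩)
    have hcontr : ∀ a, r (inclusion hj (contraction hn a)) a := by
      intro a
      by_cases ha : a.val < n - 1
      · have : inclusion hj (contraction hn a) = a := by
          ext
          simp only [inclusion, contraction]
          omega
        rw [this]
      · have h := hpath (a.val - (n - 1)) (by omega)
        have h₁ : contraction hn a = ⟨n - 1, by omega⟩ := by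
          ext
          simp only [contraction]
          omega
        have h₂ : (⟨n - 1 + (a.val - (n - 1)), by omega⟩ : Fin (n + j - 1)) = a := by
          ext
          simp only
          omega
        rw [h₂] at h
        rw [h₁]
        exact h
    intro a b hab
    exact Setoid.trans' _ (Setoid.symm' _ (hcontr a)) (Setoid.trans' _ (hincl hab) (hcontr b))

/-- Every path edge is a bridge of $G+P_j$: if one is missing, the path is not inside one component.
-/
theorem exists_eq_addPath (hn : 0 < n) (hj : 0 < j) {G : SimpleGraph (Fin n)}
    {S : Finset (Sym2 (Fin (n + j - 1)))}
    (hS : S ⊆ edges (glue G (SimpleGraph.pathGraph j))) {z : Fin (n + j - 1)}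
    (h : ∀ v : Fin (n + j - 1), n - 1 ≤ v.val →
      componentSetoid (S : Set (Sym2 (Fin (n + j - 1)))) z v) :
    ∃ T ⊆ edges G, addPath hn hj T = S := by
  classical
  have hpath : ∀ u, pathEdge hn u ∈ S := by
    intro u
    by_contra hu
    have hu2 := u.2
    set t := n - 1 + u.val with ht
    -- The two sides of the missing edge. No other edge crosses this cut, so `q` contains the
    -- component relation, yet it separates the ends `t` and `t + 1`.
    let q : Setoid (Fin (n + j - 1)) := Setoid.comap (fun v => v.val ≤ t) ⊥
    have hq : componentSetoid (S : Set (Sym2 (Fin (n + j - 1)))) ≤ q := by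
      rw [componentSetoid_le_iff]
      intro a b hab
      change (a.val ≤ t) = (b.val ≤ t)
      rcases (mem_edgeSet_glue hn hj).1 (mem_edges.1 (hS hab)) with ⟨f, hf, hfe⟩ | ⟨w, hw⟩
      · induction f with
        | _ c d =>
          have hc := c.2
          have hd := d.2
          rcases Sym2.eq_iff.1 (show s(inclusion hj c, inclusion hj d) = s(a, b) from hfe) with
            ⟨rfl, rfl⟩ | ⟨rfl, rfl⟩ <;> simp only [inclusion, eq_iff_iff] <;> omega
      · have hwu : w.val ≠ u.val := by
          intro h'
          have : w = u := Fin.ext h'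
          rw [← this, hw] at hu
          exact hu hab
        rcases Sym2.eq_iff.1 hw with ⟨rfl, rfl⟩ | ⟨rfl, rfl⟩ <;> simp only [eq_iff_iff] <;> omega
    have h₁ := h ⟨t, by omega⟩ (by simp only; omega)
    have h₂ := h ⟨t + 1, by omega⟩ (by simp only; omega)
    have h₃ : (t ≤ t) = (t + 1 ≤ t) := hq (Setoid.trans' _ (Setoid.symm' _ h₁) h₂)
    simp at h₃
  refine ⟨(edges G).filter fun f => f.map (inclusion hj) ∈ S, Finset.filter_subset _ _, ?_⟩
  ext e
  rw [mem_addPath]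
  constructor
  · rintro (⟨f, hf, rfl⟩ | ⟨u, rfl⟩)
    · exact (Finset.mem_filter.1 hf).2
    · exact hpath u
  · intro he
    rcases (mem_edgeSet_glue hn hj).1 (mem_edges.1 (hS he)) with ⟨f, hf, rfl⟩ | h
    · exact Or.inl ⟨f, Finset.mem_filter.2 ⟨mem_edges.2 hf, he⟩, rfl⟩
    · exact Or.inr h

theorem addPath_subset (hn : 0 < n) (hj : 0 < j) {G : SimpleGraph (Fin n)}
    {S : Finset (Sym2 (Fin n))} (hS : S ⊆ edges G) :
    addPath hn hj S ⊆ edges (glue G (SimpleGraph.pathGraph j)) := by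
  intro e he
  rw [mem_edges, mem_edgeSet_glue hn hj]
  rcases (mem_addPath hn hj).1 he with ⟨f, hf, rfl⟩ | h
  · exact Or.inl ⟨f, mem_edges.1 (hS hf), rfl⟩
  · exact Or.inr h

/-- The classes of `G + P_j` correspond to those of `G`. -/
def contractClass (hn : 0 < n) (r : Setoid (Fin n))
    (C : Quotient (r.comap (contraction (j := j) hn))) :
    Quotient r :=
  Quotient.lift (fun v => Quotient.mk r (contraction hn v)) (fun _ _ h => Quotient.sound h) C

theorem contractClass_bijective (hn : 0 < n) (hj : 0 < j) (r : Setoid (Fin n)) :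
    Function.Bijective (contractClass (j := j) hn r) := by
  constructor
  · intro C D h
    obtain ⟨a, rfl⟩ := Quotient.exists_rep C
    obtain ⟨b, rfl⟩ := Quotient.exists_rep D
    exact Quotient.sound (s := r.comap (contraction hn)) (Quotient.exact (s := r) h)
  · intro C
    obtain ⟨a, rfl⟩ := Quotient.exists_rep C
    refine ⟨Quotient.mk _ (inclusion hj a), ?_⟩
    exact congrArg (Quotient.mk r) (contraction_inclusion hn hj a)

open Classical in
-- The contraction has one-point fibres except over `z`, whose fibre is the whole path with its `j`
-- vertices.
theorem classSize_comap_contraction (hn : 0 < n) (hj : 0 < j) (r : Setoid (Fin n))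
    (C : Quotient (r.comap (contraction (j := j) hn))) {z : Fin n} (hz : z.val = n - 1) :
    classSize C = classSize (contractClass hn r C) +
      if Quotient.mk r z = contractClass hn r C then j - 1 else 0 := by
  have hset : {v | Quotient.mk (r.comap (contraction hn)) v = C} =
      inclusion hj '' {u | Quotient.mk r u = contractClass hn r C} ∪
        if Quotient.mk r z = contractClass hn r C then {v | n ≤ v.val} else ∅ := by
    ext v
    have h₁ : Quotient.mk (r.comap (contraction hn)) v = C ↔
        Quotient.mk r (contraction hn v) = contractClass hn r C :=
      (contractClass_bijective hn hj r).1.eq_iff.symm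
    change Quotient.mk (r.comap (contraction hn)) v = C ↔ _
    rw [h₁]
    by_cases hv : n ≤ v.val
    · have hvz : contraction hn v = z := by
        ext
        simp only [contraction]
        omega
      have hni : v ∉ inclusion hj '' {u | Quotient.mk r u = contractClass hn r C} := by
        rintro ⟨u, -, rfl⟩
        have := u.2
        simp only [inclusion] at hv
        omega
      rw [hvz, Set.mem_union, or_iff_right hni]
      split_ifs with h
      · simpa [h] using hv
      · simp [h]
    · have hv' : v ∉ (if Quotient.mk r z = contractClass hn r C then {v | n ≤ v.val} else ∅ :
          Set (Fin (n + j - 1))) := by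
        split_ifs
        · exact hv
        · simp
      rw [Set.mem_union, or_iff_left hv']
      have hvi : inclusion hj (contraction hn v) = v := by
        ext
        simp only [inclusion, contraction]
        omega
      constructor
      · intro h
        exact ⟨_, h, hvi⟩
      · rintro ⟨u, hu, rfl⟩
        rw [contraction_inclusion]
        exact hu
  have hcard : {v : Fin (n + j - 1) | n ≤ v.val}.ncard = j - 1 := by
    have : {v : Fin (n + j - 1) | n ≤ v.val} =
        (fun u : Fin (j - 1) => (⟨n + u.val, by omega⟩ : Fin (n + j - 1))) '' Set.univ := by
      ext v
      constructor
      · intro hv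
        have hv : n ≤ v.val := hv
        exact ⟨⟨v.val - n, by omega⟩, trivial, Fin.ext (by simp only; omega)⟩
      · rintro ⟨u, -, rfl⟩
        exact Nat.le_add_right _ _
    rw [this, Set.ncard_image_of_injective, Set.ncard_univ, Nat.card_eq_fintype_card,
      Fintype.card_fin]
    intro u v h
    have := Fin.ext_iff.1 h
    exact Fin.ext (by simp only at this; omega)
  rw [classSize, hset, Set.ncard_union_eq _ (Set.toFinite _) (Set.toFinite _),
    Set.ncard_image_of_injective _ (inclusion_injective hj), classSize]
  · congr 1
    split_ifs
    · exact hcard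
    · simp
  · rw [Set.disjoint_left]
    rintro _ ⟨u, -, rfl⟩ h
    have := u.2
    split_ifs at h
    · have h : n ≤ u.val := h
      omega
    · exact h

end Lift

open Classical in
/-- The entries of the forest triple matrix as alternating sums over all edge sets of `G`. -/
theorem forestTripleMatrix_eq_sum_powerset {n : ℕ} (G : SimpleGraph (Fin n))
    (o : ∀ j : ℕ+, LinearOrder (glue G (SimpleGraph.pathGraph (j : ℕ))).edgeSet) (i j : ℕ+)
    (x z : Fin n) (hx : x.val = 0) (hz : z.val = n - 1) :
    forestTripleMatrix G o i j = ∑ S ∈ (edges G).powerset, (-1) ^ S.card *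
      ((-1) ^ (n + Fintype.card (Quotient (componentSetoid (S : Set (Sym2 (Fin n)))))) *
        ∏ C : Quotient (componentSetoid (S : Set (Sym2 (Fin n)))),
          treeWeight i j (Quotient.mk _ x = C) (Quotient.mk _ z = C)
            (classSize C + if Quotient.mk _ z = C then (j : ℕ) - 1 else 0)) := by
  have hj : 0 < (j : ℕ) := j.pos
  have hn : 0 < n := x.pos
  rw [forestTripleMatrix_eq_sum_noBrokenCircuitSets G o i j (inclusion hj x) (inclusion hj z) hx hz]
  refine (sum_noBrokenCircuitSets (o j) (fun r : Setoid (Fin (n + j - 1)) =>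
    if ∀ v : Fin (n + j - 1), n - 1 ≤ v.val → r (inclusion hj z) v then
      ∏ C : Quotient r, treeWeight i j (Quotient.mk r (inclusion hj x) = C)
        (Quotient.mk r (inclusion hj z) = C) (classSize C) else 0)).trans ?_
  symm
  refine Finset.sum_of_injOn (addPath hn hj) (addPath_injective hn hj).injOn ?_ ?_ ?_
  · intro S hS
    exact Finset.mem_coe.2 (Finset.mem_powerset.2
      (addPath_subset hn hj (Finset.mem_powerset.1 (Finset.mem_coe.1 hS))))
  · intro S hS hS'
    rw [if_neg, mul_zero, mul_zero]
    intro h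
    obtain ⟨T, hT, hTS⟩ := exists_eq_addPath hn hj (Finset.mem_powerset.1 hS) h
    exact hS' ⟨T, Finset.mem_coe.2 (Finset.mem_powerset.2 hT), hTS⟩
  · intro S hS
    rw [componentSetoid_addPath, if_pos]
    · have hb := contractClass_bijective hn hj (componentSetoid (S : Set (Sym2 (Fin n))))
      rw [Fintype.card_of_bijective hb, card_addPath]
      rw [← Fintype.prod_bijective _ hb (fun C => treeWeight i j
        (Quotient.mk _ (inclusion hj x) = C) (Quotient.mk _ (inclusion hj z) = C) (classSize C))]
      · rw [← mul_assoc, ← mul_assoc, ← pow_add, ← pow_add]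
        congr 1
        -- The path adds `j - 1` edges and `j - 1` vertices, so the sign is unchanged.
        rw [show ∀ c, S.card + (j - 1) + (n + j - 1 + c) = 2 * (j - 1) + (S.card + (n + c)) by
          intro c; omega, pow_add _ (2 * _), Even.neg_one_pow (even_two_mul _), one_mul]
      · intro C
        have hmk : ∀ v : Fin n, (Quotient.mk _ (inclusion hj v) = C) =
            (Quotient.mk _ v = contractClass hn (componentSetoid (S : Set (Sym2 (Fin n)))) C) := by
          intro v
          rw [← hb.1.eq_iff]
          refine congrArg (fun t => Quotient.mk _ t = _) ?_
          exact contraction_inclusion hn hj v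
        rw [hmk x, hmk z, classSize_comap_contraction hn hj _ C hz]
    · intro v hv
      rw [Setoid.comap_rel, contraction_inclusion]
      have : contraction hn v = z := by
        ext
        simp only [contraction]
        omega
      rw [this]

/-! ### The chromatic symmetric function of `G°` -/

section Colourings

variable {n : ℕ} {r : Setoid (Fin n)} {x z : Fin n}

theorem sum_single_erase [DecidableEq (Quotient r)] (z : Fin n) (g : Quotient r → ℕ+) :
    ∑ v ∈ Finset.univ.erase z, Finsupp.single (g (Quotient.mk r v)) 1 =
      ∑ C, Finsupp.single (g C) (classSize C - if Quotient.mk r z = C then 1 else 0) := by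
  have h₁ : ∑ v, Finsupp.single (g (Quotient.mk r v)) 1 =
      ∑ C, Finsupp.single (g C) (classSize C) := by
    rw [← Finset.sum_fiberwise Finset.univ (fun v => Quotient.mk r v)]
    refine Finset.sum_congr rfl fun C _ => ?_
    rw [Finset.sum_congr rfl fun v hv => by rw [(Finset.mem_filter.1 hv).2], Finset.sum_const,
      Finsupp.smul_single, smul_eq_mul, mul_one, classSize, Set.ncard_eq_toFinset_card']
    congr 2
    ext v
    simp
  rw [← Finset.add_sum_erase _ _ (Finset.mem_univ z)] at h₁
  -- The contribution of `z` is added back on both sides, which avoids the truncated subtraction.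
  have h₂ : Finsupp.single (g (Quotient.mk r z)) 1 +
      ∑ C, Finsupp.single (g C) (classSize C - if Quotient.mk r z = C then 1 else 0) =
      ∑ C, Finsupp.single (g C) (classSize C) := by
    rw [← Finset.add_sum_erase _ _ (Finset.mem_univ (Quotient.mk r z)),
      ← Finset.add_sum_erase _ (fun C => Finsupp.single (g C) (classSize C))
        (Finset.mem_univ (Quotient.mk r z)), if_pos rfl, ← add_assoc, ← Finsupp.single_add,
      Nat.add_sub_cancel' (classSize_pos _)]
    congr 1
    refine Finset.sum_congr rfl fun C hC => ?_
    rw [if_neg (Finset.ne_of_mem_erase hC).symm, Nat.sub_zero]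
  exact add_left_cancel (h₁.trans h₂.symm)

theorem classSize_add_classSize_le {C D : Quotient r} (h : C ≠ D) :
    classSize C + classSize D ≤ n := by
  classical
  conv_rhs => rw [← sum_classSize r]
  rw [← Finset.sum_pair h]
  exact Finset.sum_le_sum_of_subset (Finset.subset_univ _)

theorem classSize_le (C : Quotient r) : classSize C ≤ n := by
  conv_rhs => rw [← sum_classSize r]
  exact Finset.single_le_sum (fun _ _ => Nat.zero_le _) (Finset.mem_univ C)

theorem two_le_classSize (hxz : x ≠ z) (h : Quotient.mk r x = Quotient.mk r z) :
    2 ≤ classSize (Quotient.mk r z) := by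
  rw [classSize, ← Set.ncard_pair hxz]
  refine Set.ncard_le_ncard ?_ (Set.toFinite _)
  rintro v (rfl | rfl)
  · exact h
  · rfl

/-- The product of power sums that counts the colourings of the vertices other than `z` that are
constant on the classes of `r` and for which `z` gets the colour of `x`. -/
def classProduct [DecidableEq (Quotient r)] (x z : Fin n) : PowerSeriesRing :=
  if Quotient.mk r x = Quotient.mk r z then
    ∏ C : Quotient r, powerSum (classSize C - if Quotient.mk r z = C then 1 else 0)
  else ∏ C ∈ Finset.univ.erase (Quotient.mk r z), powerSum (classSize C +
    if Quotient.mk r x = C then classSize (Quotient.mk r z) - 1 else 0)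

/-- Colours are chosen freely, one for each class, and `z` is left out of the monomial. If `x` and
`z` lie in different classes, the condition `κ x = κ z` lets the class of `z` take over the colour
of the class of `x`; this merges the two into one power sum. -/
theorem coeff_classProduct [DecidableEq (Quotient r)] (hxz : x ≠ z) (d : ℕ+ →₀ ℕ) :
    MvPowerSeries.coeff d (classProduct (r := r) x z) =
      (Nat.card {κ : Fin n → ℕ+ // (κ x = κ z ∧
        ∑ v ∈ Finset.univ.erase z, Finsupp.single (κ v) 1 = d) ∧ r ≤ Setoid.ker κ} : ℤ) := by
  unfold classProduct
  split_ifs with h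
  · rw [coeff_prod_powerSum, Nat.cast_inj]
    · refine Nat.card_eq_of_bijective (fun f => ⟨fun v => f.1 (Quotient.mk r v),
        ⟨congrArg f.1 h, (sum_single_erase z f.1).trans f.2⟩,
        fun a b hab => congrArg f.1 (Quotient.sound hab)⟩) ⟨?_, ?_⟩
      · intro f f' hf
        refine Subtype.ext (funext fun C => ?_)
        obtain ⟨v, rfl⟩ := Quotient.exists_rep C
        exact congrFun (Subtype.ext_iff.1 hf) v
      · rintro ⟨κ, ⟨h₁, h₂⟩, h₃⟩
        exact ⟨⟨Quotient.lift κ fun a b hab => h₃ hab, (sum_single_erase z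
          (Quotient.lift κ fun a b hab => h₃ hab)).symm.trans h₂⟩, rfl⟩
    · intro C
      have := classSize_pos C
      split_ifs with hC
      · subst hC
        have := two_le_classSize hxz h
        omega
      · exact this
  · rw [← Finset.prod_coe_sort, coeff_prod_powerSum, Nat.cast_inj]
    · have hmem : ∀ C : Quotient r, (if C = Quotient.mk r z then Quotient.mk r x else C) ∈
          Finset.univ.erase (Quotient.mk r z) := by
        intro C
        refine Finset.mem_erase.2 ⟨?_, Finset.mem_univ _⟩
        split_ifs with hC
        · exact h
        · exact hC
      let extend (f : ↥(Finset.univ.erase (Quotient.mk r z)) → ℕ+) (C : Quotient r) : ℕ+ :=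
        f ⟨_, hmem C⟩
      have hext : ∀ (f : ↥(Finset.univ.erase (Quotient.mk r z)) → ℕ+)
          (C : ↥(Finset.univ.erase (Quotient.mk r z))), extend f C.1 = f C := by
        intro f C
        refine congrArg f (Subtype.ext ?_)
        exact if_neg (Finset.ne_of_mem_erase C.2)
      have hextz : ∀ f, extend f (Quotient.mk r z) = extend f (Quotient.mk r x) := by
        intro f
        refine congrArg f (Subtype.ext ?_)
        simp
      have hsum : ∀ f, ∑ v ∈ Finset.univ.erase z, Finsupp.single (extend f (Quotient.mk r v)) 1 =
          ∑ C : ↥(Finset.univ.erase (Quotient.mk r z)), Finsupp.single (f C) (classSize C.1 +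
            if Quotient.mk r x = C.1 then classSize (Quotient.mk r z) - 1 else 0) := by
        intro f
        rw [sum_single_erase, ← Finset.add_sum_erase _ _ (Finset.mem_univ (Quotient.mk r z)),
          if_pos rfl, hextz]
        simp only [Finsupp.single_add, Finset.sum_add_distrib]
        rw [add_comm]
        congr 1
        · rw [← Finset.sum_coe_sort]
          refine Finset.sum_congr rfl fun C _ => ?_
          rw [hext, if_neg (Finset.ne_of_mem_erase C.2).symm, Nat.sub_zero]
        · rw [Finset.sum_eq_single
            (⟨Quotient.mk r x, Finset.mem_erase.2 ⟨h, Finset.mem_univ _⟩⟩ :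
              ↥(Finset.univ.erase (Quotient.mk r z)))]
          · rw [if_pos rfl, ← hext f ⟨Quotient.mk r x, Finset.mem_erase.2 ⟨h, Finset.mem_univ _⟩⟩]
          · intro C _ hC
            rw [if_neg, Finsupp.single_zero]
            exact fun h' => hC (Subtype.ext h'.symm)
          · simp
      refine Nat.card_eq_of_bijective (fun f => ⟨fun v => extend f.1 (Quotient.mk r v),
        ⟨(hextz f.1).symm, (hsum f.1).trans f.2⟩,
        fun a b hab => congrArg (extend f.1) (Quotient.sound hab)⟩) ⟨?_, ?_⟩
      · intro f f' hf
        refine Subtype.ext (funext fun C => ?_)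
        obtain ⟨v, hv⟩ := Quotient.exists_rep C.1
        have : extend f.1 (Quotient.mk r v) = extend f'.1 (Quotient.mk r v) :=
          congrFun (Subtype.ext_iff.1 hf) v
        rw [← hext f.1 C, ← hext f'.1 C, ← hv]
        exact this
      · rintro ⟨κ, ⟨h₁, h₂⟩, h₃⟩
        let f : ↥(Finset.univ.erase (Quotient.mk r z)) → ℕ+ := fun C =>
          Quotient.lift κ (fun a b hab => h₃ hab) C.1
        have hf : ∀ v, extend f (Quotient.mk r v) = κ v := by
          intro v
          by_cases hv : Quotient.mk r v = Quotient.mk r z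
          · have h₄ : κ v = κ z := h₃ (Quotient.exact hv)
            exact (congrArg (extend f) hv).trans ((hextz f).trans ((hext f ⟨Quotient.mk r x,
              Finset.mem_erase.2 ⟨h, Finset.mem_univ _⟩⟩).trans (h₁.trans h₄.symm)))
          · exact hext f ⟨Quotient.mk r v, Finset.mem_erase.2 ⟨hv, Finset.mem_univ _⟩⟩
        refine ⟨⟨f, ?_⟩, Subtype.ext (funext hf)⟩
        rw [← hsum f, ← h₂]
        exact Finset.sum_congr rfl fun v _ => by rw [hf]
    · exact fun C => Nat.add_pos_left (classSize_pos _) _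

end Colourings

/-- A colouring whose monomial is known uses finitely many colours. -/
theorem finite_colourings {V : Type*} [Finite V] (s : Finset V) (d : ℕ+ →₀ ℕ) (P : (V → ℕ+) → Prop)
    (hP : ∀ κ, P κ → ∀ v, ∃ w ∈ s, κ v = κ w) :
    {κ : V → ℕ+ | P κ ∧ ∑ v ∈ s, Finsupp.single (κ v) 1 = d}.Finite := by
  refine Set.Finite.subset (Set.Finite.pi' fun _ : V => d.support.finite_toSet) ?_
  rintro κ ⟨hκ, rfl⟩ v
  obtain ⟨w, hw, h⟩ := hP κ hκ v
  rw [h, Finset.mem_coe, Finsupp.mem_support_iff, Finsupp.finsetSum_apply]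
  refine (Finset.sum_pos' (fun _ _ => Nat.zero_le _) ⟨w, hw, ?_⟩).ne'
  simp

/-- Proper colourings of `G°` are proper colourings of `G` for which the first and the last vertex
have the same colour. -/
theorem coeff_chromaticSymmetricFunction_closeUp {n : ℕ} (hn : 2 ≤ n) (G : SimpleGraph (Fin n))
    {x z : Fin n} (hx : x.val = 0) (hz : z.val = n - 1) (d : ℕ+ →₀ ℕ) :
    MvPowerSeries.coeff d (chromaticSymmetricFunction (closeUp hn G)) =
      (Nat.card {κ : Fin n → ℕ+ // (κ x = κ z ∧
        ∑ v ∈ Finset.univ.erase z, Finsupp.single (κ v) 1 = d) ∧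
        ∀ a b, G.Adj a b → κ a ≠ κ b} : ℤ) := by
  change ((Nat.card _ : ℕ) : ℤ) = _
  rw [Nat.cast_inj]
  -- A section of `identifyEnds` that avoids `z`; going to $G^\circ$ and back sends `z` to `x` and
  -- fixes all other vertices.
  let ι : Fin (n - 1) → Fin n := fun v => ⟨v.val, by omega⟩
  have hidι : ∀ v, identifyEnds hn (ι v) = v := by
    intro v
    simp [identifyEnds, ι]
  have hidx : identifyEnds hn x = identifyEnds hn z := by
    ext
    simp only [identifyEnds, hx, hz, lt_irrefl, dif_neg, not_false_iff]
    split_ifs <;> rfl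
  have hιid : ∀ v, v ≠ z → ι (identifyEnds hn v) = v := by
    intro v hv
    have : v.val ≠ n - 1 := fun h => hv (Fin.ext (h.trans hz.symm))
    ext
    simp only [identifyEnds, ι]
    rw [dif_pos (by omega)]
  have hιz : ι (identifyEnds hn z) = x := by
    ext
    simp [identifyEnds, ι, hx, hz]
  have hsum : ∀ κ : Fin n → ℕ+, ∑ v ∈ Finset.univ.erase z, Finsupp.single (κ v) 1 =
      ∑ᶠ v : (closeUp hn G).vertexSet, Finsupp.single (κ (ι v.1)) 1 := by
    intro κ
    have : Fintype (closeUp hn G).vertexSet := Fintype.ofFinite _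
    rw [finsum_eq_sum_of_fintype]
    symm
    refine Finset.sum_bij (fun v _ => ι v.1) ?_ ?_ ?_ (fun _ _ => rfl)
    · intro v _
      refine Finset.mem_erase.2 ⟨fun h => ?_, Finset.mem_univ _⟩
      have := congrArg Fin.val h
      have := v.1.2
      simp only [ι] at *
      omega
    · intro v _ w _ h
      refine Subtype.ext ?_
      rw [← hidι v.1, h, hidι]
    · intro v hv
      exact ⟨⟨identifyEnds hn v, trivial⟩, Finset.mem_univ _, hιid v (Finset.ne_of_mem_erase hv)⟩
  symm
  refine Nat.card_eq_of_bijective (fun κ => ⟨fun v => κ.1 (ι v.1), ?_, ?_⟩) ⟨?_, ?_⟩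
  · obtain ⟨κ, ⟨h₁, h₂⟩, h₃⟩ := κ
    have hκ : ∀ v, κ (ι (identifyEnds hn v)) = κ v := by
      intro v
      by_cases hv : v = z
      · rw [hv, hιz, h₁]
      · rw [hιid v hv]
    rintro e ⟨a, _⟩ ⟨b, _⟩ ⟨he, hab⟩
    induction e with
    | _ u v =>
      have huv := h₃ u v he
      rw [← hκ u, ← hκ v] at huv
      rcases Sym2.eq_iff.1 (show s(identifyEnds hn u, identifyEnds hn v) = s(a, b) from hab) with
        ⟨rfl, rfl⟩ | ⟨rfl, rfl⟩
      · exact huv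
      · exact huv.symm
  · rw [← hsum]
    exact κ.2.1.2
  · rintro ⟨κ, ⟨h₁, h₂⟩, h₃⟩ ⟨κ', ⟨h₁', h₂'⟩, h₃'⟩ h
    have h : ∀ v : Fin (n - 1), κ (ι v) = κ' (ι v) := fun v =>
      congrFun (Subtype.ext_iff.1 h) ⟨v, trivial⟩
    refine Subtype.ext (funext fun v => ?_)
    change κ v = κ' v
    by_cases hv : v = z
    · rw [hv, ← h₁, ← h₁', ← hιz, h]
    · rw [← hιid v hv, h]
  · rintro ⟨κ, h₁, h₂⟩
    refine ⟨⟨fun v => κ ⟨identifyEnds hn v, trivial⟩, ⟨?_, ?_⟩, ?_⟩, ?_⟩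
    · simp only [hidx]
    · rw [hsum, ← h₂]
      simp only [hidι]
    · intro a b hab
      exact h₁ s(a, b) _ _ ⟨hab, rfl⟩
    · refine Subtype.ext (funext fun v => ?_)
      simp only [hidι]

open Classical in
/-- The expansion of the chromatic symmetric function of `G°` in power sums. -/
theorem chromaticSymmetricFunction_closeUp_eq_sum {n : ℕ} (hn : 2 ≤ n) (G : SimpleGraph (Fin n))
    {x z : Fin n} (hx : x.val = 0) (hz : z.val = n - 1) :
    chromaticSymmetricFunction (closeUp hn G) = ∑ S ∈ (edges G).powerset,
      (-1) ^ S.card * classProduct (r := componentSetoid (S : Set (Sym2 (Fin n)))) x z := by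
  have hxz : x ≠ z := fun h => by
    have := congrArg Fin.val h
    omega
  ext d
  have hfin : {κ : Fin n → ℕ+ | κ x = κ z ∧
      ∑ v ∈ Finset.univ.erase z, Finsupp.single (κ v) 1 = d}.Finite := by
    refine finite_colourings _ d _ fun κ hκ v => ?_
    by_cases hv : v = z
    · exact ⟨x, Finset.mem_erase.2 ⟨hxz, Finset.mem_univ _⟩, by rw [hv, hκ]⟩
    · exact ⟨v, Finset.mem_erase.2 ⟨hv, Finset.mem_univ _⟩, rfl⟩
  have hcard : ∀ P : (Fin n → ℕ+) → Prop, (Nat.card {κ : Fin n → ℕ+ // (κ x = κ z ∧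
      ∑ v ∈ Finset.univ.erase z, Finsupp.single (κ v) 1 = d) ∧ P κ} : ℤ) =
      ∑ κ ∈ hfin.toFinset, if P κ then 1 else 0 := by
    intro P
    rw [Finset.sum_boole, Nat.cast_inj, ← Nat.card_eq_finsetCard]
    refine Nat.card_congr (Equiv.subtypeEquivRight fun κ => ?_)
    rw [Finset.mem_filter, Set.Finite.mem_toFinset]
    rfl
  have hcoeff : ∀ S : Finset (Sym2 (Fin n)), MvPowerSeries.coeff d
      ((-1) ^ S.card * classProduct (r := componentSetoid (S : Set (Sym2 (Fin n)))) x z) =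
      ∑ κ ∈ hfin.toFinset, if componentSetoid (S : Set (Sym2 (Fin n))) ≤ Setoid.ker κ then
        (-1) ^ S.card else 0 := by
    intro S
    have : ((-1) ^ S.card : PowerSeriesRing) *
        classProduct (r := componentSetoid (S : Set (Sym2 (Fin n)))) x z =
        ((-1) ^ S.card : ℤ) • classProduct (r := componentSetoid (S : Set (Sym2 (Fin n)))) x z := by
      rw [zsmul_eq_mul]
      push_cast
      rfl
    rw [this, map_zsmul, coeff_classProduct hxz, hcard, smul_eq_mul, Finset.mul_sum]
    refine Finset.sum_congr rfl fun κ _ => ?_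
    rw [mul_ite, mul_one, mul_zero]
  rw [coeff_chromaticSymmetricFunction_closeUp hn G hx hz, hcard, map_sum,
    Finset.sum_congr rfl fun S _ => hcoeff S, Finset.sum_comm]
  refine Finset.sum_congr rfl fun κ _ => ?_
  -- A colouring is constant on the components of `S` exactly when all edges of `S` are
  -- monochromatic. The alternating sum over such `S` is then $1$ if no edge of `G` is monochromatic
  -- and $0$ otherwise.
  have hfilter : (edges G).powerset.filter (fun S : Finset (Sym2 (Fin n)) =>
      componentSetoid (S : Set (Sym2 (Fin n))) ≤ Setoid.ker κ) =
      ((edges G).filter fun e => (e.map κ).IsDiag).powerset := by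
    ext S
    rw [Finset.mem_filter, Finset.mem_powerset, Finset.mem_powerset, componentSetoid_le_iff]
    constructor
    · rintro ⟨h₁, h₂⟩ e he
      refine Finset.mem_filter.2 ⟨h₁ he, ?_⟩
      induction e with
      | _ a b => exact h₂ a b he
    · intro h
      exact ⟨fun e he => (Finset.mem_filter.1 (h he)).1,
        fun a b hab => (Finset.mem_filter.1 (h hab)).2⟩
  rw [← Finset.sum_filter, hfilter, Finset.sum_powerset_neg_one_pow_card]
  have hiff : (∀ a b, G.Adj a b → κ a ≠ κ b) ↔
      (edges G).filter (fun e => (e.map κ).IsDiag) = ∅ := by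
    rw [Finset.filter_eq_empty_iff]
    constructor
    · intro h e he
      induction e with
      | _ a b => exact h a b (mem_edges.1 he)
    · intro h a b hab
      exact h (mem_edges.2 hab : s(a, b) ∈ edges G)
  by_cases h : (edges G).filter (fun e => (e.map κ).IsDiag) = ∅
  · rw [if_pos (hiff.2 h), if_pos h]
  · rw [if_neg (fun h' => h (hiff.1 h')), if_neg h]

/-! ### The trace -/

theorem treeWeight_congr {i j m m' : ℕ} {a a' b b' : Prop} (ha : a ↔ a') (hb : b ↔ b')
    (hm : m = m') : treeWeight i j a b m = treeWeight i j a' b' m' := by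
  rw [propext ha, propext hb, hm]

section Trace

variable {n : ℕ} {r : Setoid (Fin n)} {x z : Fin n}

open Classical in
/-- The contribution of an edge set of `G` with components `r` to the entry `(k, k)` of the forest
triple matrix, up to sign. -/
def diagonalProduct (r : Setoid (Fin n)) (x z : Fin n) (k : ℕ) : PowerSeriesRing :=
  ∏ C : Quotient r, treeWeight k k (Quotient.mk r x = C) (Quotient.mk r z = C)
    (classSize C + if Quotient.mk r z = C then k - 1 else 0)

open Classical in
theorem diagonalProduct_of_eq (h : Quotient.mk r x = Quotient.mk r z) (hxz : x ≠ z) (k : ℕ) :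
    diagonalProduct r x z (k + 1) = treeWeight (k + 1) (k + 1) True True
      (k + 1 + (classSize (Quotient.mk r z) - 1)) *
      ∏ C ∈ Finset.univ.erase (Quotient.mk r z), signedPowerSum (classSize C) := by
  rw [diagonalProduct, ← Finset.mul_prod_erase _ _ (Finset.mem_univ (Quotient.mk r z)), if_pos rfl]
  have := two_le_classSize hxz h
  congr 1
  · exact treeWeight_congr (iff_true_intro h) (iff_true_intro rfl) (by omega)
  · refine Finset.prod_congr rfl fun C hC => ?_
    have hC := (Finset.ne_of_mem_erase hC).symm
    rw [treeWeight_of_not_of_not _ _ (h ▸ hC) hC, if_neg hC, add_zero]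

open Classical in
theorem diagonalProduct_of_ne (h : Quotient.mk r x ≠ Quotient.mk r z) (k : ℕ) :
    diagonalProduct r x z (k + 1) =
      treeWeight (k + 1) (k + 1) True False (classSize (Quotient.mk r x)) *
      treeWeight (k + 1) (k + 1) False True (classSize (Quotient.mk r z) + k) *
      ∏ C ∈ (Finset.univ.erase (Quotient.mk r z)).erase (Quotient.mk r x),
        signedPowerSum (classSize C) := by
  rw [diagonalProduct, ← Finset.mul_prod_erase _ _ (Finset.mem_univ (Quotient.mk r z)),
    ← Finset.mul_prod_erase _ _ (Finset.mem_erase.2 ⟨h, Finset.mem_univ (Quotient.mk r x)⟩),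
    if_pos rfl, if_neg h.symm, mul_left_comm, ← mul_assoc]
  refine congrArg₂ (· * ·) (congrArg₂ (· * ·) ?_ ?_) ?_
  · exact treeWeight_congr (iff_true_intro rfl) (iff_false_intro h.symm) rfl
  · exact treeWeight_congr (iff_false_intro h) (iff_true_intro rfl) rfl
  · refine Finset.prod_congr rfl fun C hC => ?_
    have hx := (Finset.ne_of_mem_erase hC).symm
    have hz := (Finset.ne_of_mem_erase (Finset.mem_of_mem_erase hC)).symm
    rw [treeWeight_of_not_of_not _ _ hx hz, if_neg hz, add_zero]

/-- The index is too large for the parts. In a common class, at most $n-1$ vertices are left after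
the first part, so no last part exceeds $k$. Otherwise the class of `x` has fewer than $n$ vertices
and no part $k+1$. -/
theorem diagonalProduct_eq_zero (hxz : x ≠ z) {k : ℕ} (hk : n ≤ k + 1) :
    diagonalProduct r x z (k + 1) = 0 := by
  classical
  by_cases h : Quotient.mk r x = Quotient.mk r z
  · have h₁ := two_le_classSize hxz h
    have h₂ := classSize_le (Quotient.mk r z)
    rw [diagonalProduct_of_eq h hxz, treeWeight_of_mem_of_mem trivial trivial (by omega),
      Finset.sum_eq_zero, neg_zero, zero_mul]
    intro s hs
    have := (Finset.mem_Icc.1 hs).2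
    rw [if_neg (by omega)]
  · have h₁ := classSize_add_classSize_le h
    have h₂ := classSize_pos (Quotient.mk r z)
    rw [diagonalProduct_of_ne h, treeWeight_of_mem_of_not k.succ_pos trivial not_false,
      if_neg (by omega), zero_mul, zero_mul]

theorem prod_signedPowerSum (s : Finset (Quotient r)) :
    ∏ C ∈ s, signedPowerSum (classSize C) =
      (∏ C ∈ s, (-1) ^ (classSize C - 1)) * ∏ C ∈ s, powerSum (classSize C) := by
  rw [← Finset.prod_mul_distrib]
  exact Finset.prod_congr rfl fun C _ => signedPowerSum_eq_powerSum (classSize_pos C)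

/-- The class sizes minus one add up to $n$ minus the number of classes, so the total exponent is
$2n$. -/
theorem neg_one_pow_mul_prod_neg_one_pow (r : Setoid (Fin n)) :
    (-1 : PowerSeriesRing) ^ (n + Fintype.card (Quotient r)) *
      ∏ C : Quotient r, (-1) ^ (classSize C - 1) = 1 := by
  have h : ∑ C : Quotient r, (classSize C - 1) + Fintype.card (Quotient r) = n := by
    rw [← Finset.card_univ, Finset.card_eq_sum_ones, ← Finset.sum_add_distrib]
    conv_rhs => rw [← sum_classSize r]
    exact Finset.sum_congr rfl fun C _ => Nat.sub_add_cancel (classSize_pos C)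
  rw [Finset.prod_pow_eq_pow_sum, ← pow_add]
  exact Even.neg_one_pow ⟨n, by omega⟩

open Classical in
-- Summing over the diagonal performs the gluing of `x` and `z` on each partition: sizes $a,b$
-- become $a+b-1$, or a common class loses one element. In both cases the sign of the special
-- factors is the product of $(-1)^{|C|-1}$ over the classes involved, so the total sign cancels.
theorem sum_diagonalProduct (hxz : x ≠ z) :
    ∑ k ∈ Finset.range (n - 1), (-1) ^ (n + Fintype.card (Quotient r)) *
      diagonalProduct r x z (k + 1) = classProduct (r := r) x z := by
  rw [← Finset.mul_sum, classProduct]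
  have hsign := neg_one_pow_mul_prod_neg_one_pow r
  set ε : PowerSeriesRing := (-1) ^ (n + Fintype.card (Quotient r))
  rw [← Finset.mul_prod_erase _ _ (Finset.mem_univ (Quotient.mk r z))] at hsign
  split_ifs with h
  · have h₁ := two_le_classSize hxz h
    have h₂ := classSize_le (Quotient.mk r z)
    rw [Finset.sum_congr rfl fun k _ => diagonalProduct_of_eq h hxz k, ← Finset.sum_mul,
      sum_treeWeight (by omega) (by omega) trivial trivial, prod_signedPowerSum,
      signedPowerSum_eq_powerSum (by omega),
      ← Finset.mul_prod_erase _ _ (Finset.mem_univ (Quotient.mk r z)), if_pos rfl]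
    have hprod : ∏ C ∈ Finset.univ.erase (Quotient.mk r z),
        powerSum (classSize C - if Quotient.mk r z = C then 1 else 0) =
        ∏ C ∈ Finset.univ.erase (Quotient.mk r z), powerSum (classSize C) :=
      Finset.prod_congr rfl fun C hC => by
        rw [if_neg (Finset.ne_of_mem_erase hC).symm, Nat.sub_zero]
    rw [hprod]
    obtain ⟨t, ht⟩ : ∃ t, classSize (Quotient.mk r z) = t + 2 :=
      ⟨classSize (Quotient.mk r z) - 2, by omega⟩
    rw [ht] at hsign ⊢
    simp only [show t + 2 - 1 = t + 1 by omega, show t + 1 - 1 = t by omega, pow_succ] at hsign ⊢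
    linear_combination (powerSum (t + 1) * ∏ C ∈ Finset.univ.erase (Quotient.mk r z),
      powerSum (classSize C)) * hsign
  · have h₁ := classSize_add_classSize_le h
    have h₂ := classSize_pos (Quotient.mk r z)
    have h₃ := classSize_pos (Quotient.mk r x)
    have hmem := Finset.mem_erase.2 ⟨h, Finset.mem_univ (Quotient.mk r x)⟩
    rw [← Finset.mul_prod_erase _ _ hmem] at hsign
    rw [Finset.sum_congr rfl fun k _ => diagonalProduct_of_ne h k, ← Finset.sum_mul,
      sum_treeWeight_mul_treeWeight h₃ h₂ (by omega) trivial not_false not_false trivial,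
      prod_signedPowerSum, signedPowerSum_eq_powerSum (by omega),
      ← Finset.mul_prod_erase _ _ hmem, if_pos rfl]
    have hprod : ∏ C ∈ (Finset.univ.erase (Quotient.mk r z)).erase (Quotient.mk r x),
        powerSum (classSize C +
          if Quotient.mk r x = C then classSize (Quotient.mk r z) - 1 else 0) =
        ∏ C ∈ (Finset.univ.erase (Quotient.mk r z)).erase (Quotient.mk r x),
          powerSum (classSize C) :=
      Finset.prod_congr rfl fun C hC => by
        rw [if_neg (Finset.ne_of_mem_erase hC).symm, add_zero]
    rw [hprod]
    obtain ⟨a, ha⟩ : ∃ a, classSize (Quotient.mk r x) = a + 1 :=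
      ⟨classSize (Quotient.mk r x) - 1, by omega⟩
    obtain ⟨b, hb⟩ : ∃ b, classSize (Quotient.mk r z) = b + 1 :=
      ⟨classSize (Quotient.mk r z) - 1, by omega⟩
    rw [ha, hb] at hsign ⊢
    simp only [show a + 1 + (b + 1) - 1 = a + 1 + b by omega, show a + 1 + b - 1 = a + b by omega,
      Nat.add_sub_cancel, pow_add] at hsign ⊢
    linear_combination (powerSum (a + 1 + b) *
      ∏ C ∈ (Finset.univ.erase (Quotient.mk r z)).erase (Quotient.mk r x),
        powerSum (classSize C)) * hsign

end Trace

/-! ### Diagonal entries and the infinite trace -/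

theorem forestTripleMatrix_diagonal {n : ℕ} (G : SimpleGraph (Fin n))
    (o : ∀ j : ℕ+, LinearOrder (glue G (SimpleGraph.pathGraph (j : ℕ))).edgeSet) (k : ℕ+)
    {x z : Fin n} (hx : x.val = 0) (hz : z.val = n - 1) :
    forestTripleMatrix G o k k = ∑ S ∈ (edges G).powerset, (-1) ^ S.card *
      ((-1) ^ (n + Fintype.card (Quotient (componentSetoid (S : Set (Sym2 (Fin n)))))) *
        diagonalProduct (componentSetoid (S : Set (Sym2 (Fin n)))) x z k) :=
  forestTripleMatrix_eq_sum_powerset G o k k x z hx hz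

theorem forestTripleMatrix_diagonal_eq_zero {n : ℕ} (hn : 2 ≤ n) (G : SimpleGraph (Fin n))
    (o : ∀ j : ℕ+, LinearOrder (glue G (SimpleGraph.pathGraph (j : ℕ))).edgeSet) (k : ℕ+)
    (hk : n ≤ k) : forestTripleMatrix G o k k = 0 := by
  rw [forestTripleMatrix_diagonal G o k (x := ⟨0, by omega⟩) (z := ⟨n - 1, by omega⟩) rfl rfl]
  refine Finset.sum_eq_zero fun S _ => ?_
  obtain ⟨t, rfl⟩ : ∃ t : ℕ, k = t.succPNat := ⟨k.natPred, k.succPNat_natPred.symm⟩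
  rw [Nat.succPNat_coe, Nat.succ_eq_add_one, diagonalProduct_eq_zero _ hk, mul_zero, mul_zero]
  intro h
  have := congrArg Fin.val h
  simp only at this
  omega

theorem sum_forestTripleMatrix_diagonal {n : ℕ} (hn : 2 ≤ n) (G : SimpleGraph (Fin n))
    (o : ∀ j : ℕ+, LinearOrder (glue G (SimpleGraph.pathGraph (j : ℕ))).edgeSet) :
    ∑ k ∈ Finset.range (n - 1), forestTripleMatrix G o k.succPNat k.succPNat =
      chromaticSymmetricFunction (closeUp hn G) := by
  classical
  have hxz : (⟨0, by omega⟩ : Fin n) ≠ ⟨n - 1, by omega⟩ := by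
    intro h
    have := congrArg Fin.val h
    simp only at this
    omega
  rw [chromaticSymmetricFunction_closeUp_eq_sum hn G (x := ⟨0, by omega⟩)
    (z := ⟨n - 1, by omega⟩) rfl rfl]
  simp only [forestTripleMatrix_diagonal G o _ (x := ⟨0, by omega⟩)
    (z := ⟨n - 1, by omega⟩) rfl rfl]
  -- The comparison is made for each edge set separately; the sum over the diagonal index moves
  -- inside.
  rw [Finset.sum_comm]
  refine Finset.sum_congr rfl fun S _ => ?_
  rw [← Finset.mul_sum]
  congr 1
  simp only [Nat.succPNat_coe, Nat.succ_eq_add_one]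
  convert sum_diagonalProduct hxz

theorem infiniteTrace_eq_sum_range {M : Matrix ℕ+ ℕ+ PowerSeriesRing} {m : ℕ}
    (h : ∀ k : ℕ+, m < k → M k k = 0) :
    infiniteTrace M = ∑ k ∈ Finset.range m, M k.succPNat k.succPNat := by
  classical
  rw [infiniteTrace, finsum_eq_sum_of_support_subset (s := (Finset.range m).image Nat.succPNat),
    Finset.sum_image Nat.succPNat_injective.injOn]
  intro k hk
  have hkm : (k : ℕ) ≤ m := not_lt.1 fun h' => hk (h k h')
  refine Finset.mem_coe.2 (Finset.mem_image.2 ⟨k.natPred, ?_, k.succPNat_natPred⟩)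
  have := k.pos
  rw [Finset.mem_range, PNat.natPred]
  omega

end ForestTriples

end

theorem mainTheorem3 (n : ℕ) (hn : 2 ≤ n) (G : SimpleGraph (Fin n))
    (o : ∀ j : ℕ+, LinearOrder
      (ForestTriples.glue G (SimpleGraph.pathGraph (j : ℕ))).edgeSet) :
    (∀ k : ℕ+, n ≤ (k : ℕ) → ForestTriples.forestTripleMatrix G o k k = 0) ∧
    ForestTriples.chromaticSymmetricFunction (ForestTriples.closeUp hn G) =
      ForestTriples.infiniteTrace (ForestTriples.forestTripleMatrix G o) ∧
    ForestTriples.infiniteTrace (ForestTriples.forestTripleMatrix G o) =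
      ∑ k ∈ Finset.range (n - 1),
        ForestTriples.forestTripleMatrix G o k.succPNat k.succPNat := by
  have hzero := ForestTriples.forestTripleMatrix_diagonal_eq_zero hn G o
  have htrace := ForestTriples.infiniteTrace_eq_sum_range (m := n - 1)
    (M := ForestTriples.forestTripleMatrix G o) fun k hk => hzero k (by omega)
  exact ⟨hzero, (htrace.trans (ForestTriples.sum_forestTripleMatrix_diagonal hn G o)).symm, htrace⟩
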